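/- Let $\mathcal H$ be the upper half-plane and, for $\tau\in\mathcal H$, $\Lambda_\tau=\mathbb Z\oplus\tau\mathbb Z$. Functions $f(\tau,z)$ on $\mathcal H\times\mathbb C$ are considered away from $z\in\Lambda_\tau$, and identities between them are understood for $z\notin\Lambda_\tau$. A function $f$ is *singular* if: for every $\tau$, $z\mapsto f(\tau,z)$ is $1$-periodic, meromorphic on $\mathbb C$, with no poles outside $\Lambda_\tau$ and with pole orders at the points of $\Lambda_\tau$ bounded by an integer independent of $\tau$; $\tau\mapsto f(\tau,z)$ is $1$-periodic; and every Laurent coefficient $A_n(\tau)$ of $z\mapsto f(\tau,z)$ at $z=0$ is holomorphic on $\mathcal H$ with a Fourier expansion $A_n(\tau)=\sum_{r\ge0}a_n(r)e^{2\pi i r\tau}$. For $A=\left(\begin{pmatrix}a&b\\c&d\end{pmatrix},(\lambda,\mu)\right)\in \mathrm{SL}(2,\mathbb Z)\ltimes\mathbb Z^2$ and $k\in\mathbb Z_{\ge0}$ put $$(f|_kA)(\tau,z)=(c\tau+d)^{-k}f\!\left(\frac{a\tau+b}{c\tau+d},\frac{z+\lambda\tau+\mu}{c\tau+d}\right),\quad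 X(A)=\frac{c}{c\tau+d},\quad Y(A)=\frac{cz+c\mu-d\lambda}{c\tau+d}.$$ A singular function $f$ is a *singular Jacobi form* of weight $k$ (and index $0$), written $f\in \mathrm{JS}_k$, if $f|_kA=f$ for all $A$. It is a *singular quasi-Jacobi form* of weight $k$ and depths at most $(s_1,s_2)\in\mathbb Z_{\ge0}^2$, written $f\in \mathrm{JS}_k^{\le s_1,\le s_2}$, if there are singular functions $f_{j_1,j_2}$ ($0\le j_1\le s_1$, $0\le j_2\le s_2$) with $$f|_kA=\sum_{j_1=0}^{s_1}\sum_{j_2=0}^{s_2}f_{j_1,j_2}\,X(A)^{j_1}Y(A)^{j_2}\qquad\text{for all }A.$$ Let $\mathrm{JS}=\bigoplus_{k\ge0}\mathrm{JS}_k$ be the algebra of singular Jacobi forms. Let $$e_2(\tau)=\frac{\pi^2}{3}\Bigl(1-24\sum_{n\ge1}\sigma_1(n)e^{2\pi i n\tau}\Bigr),\qquad E_1(\tau,z)=\lim_{N\to\infty}\sum_{n=-N}^{N}\Bigl(\lim_{M\to\infty}\sum_{m=-M}^{M}\frac1{z+m+n\tau}\Bigr),$$ $$\partial_z=\frac{\partial}{\partial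 z},\qquad \partial_\tau=\frac{\pi}{2i}\frac{\partial}{\partial\tau}.$$ Singular quasi-Jacobi forms are differentiable in $\tau$ (and $z$) for $z\notin\Lambda_\tau$. The Oberdieck derivation $\mathrm{Ob}^*$ is defined on forms $f$ of weight $k$ by $$\mathrm{Ob}^*(f)=4\,\partial_\tau f+E_1\,\partial_zf-k\,e_2f$$ and extended by linearity to sums of forms of different weights. **Proposition.** For all $k,s_1,s_2\in\mathbb Z_{\ge0}$: 1. $\mathrm{Ob}^*$ maps $\mathrm{JS}_k^{\le s_1,\le s_2}$ into $\mathrm{JS}_{k+2}^{\le s_1+1,\le s_2}$. 2. The algebra $\mathrm{JS}$ is stable under $\mathrm{Ob}^*$: the image under $\mathrm{Ob}^*$ of any singular Jacobi form of weight $k$ is a singular Jacobi form of weight $k+2$. -/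

import Mathlib

noncomputable section

namespace QuasiJacobi

open UpperHalfPlane
open scoped Manifold MatrixGroups ArithmeticFunction.sigma

/-- Functions of two variables on `ℍ × ℂ`. They are meromorphic in `z` with poles at most at the
points of `ℤ ⊕ ℤτ`, so only their values off the lattice are meaningful; every condition below
ignores the values on the lattice. -/
abbrev Fun2 : Type := ℍ → ℂ → ℂ

/-- The lattice `ℤ ⊕ ℤτ`. -/
def lattice (τ : ℍ) : Set ℂ := {z | ∃ m n : ℤ, z = m + n * (τ : ℂ)}

/-- `A` is holomorphic on `ℍ` and has a Fourier expansion `∑_{r ≥ 0} a_r exp(2πirτ)`. -/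
def HolomorphicWithCusp (A : ℍ → ℂ) : Prop :=
  MDifferentiable 𝓘(ℂ) 𝓘(ℂ) A ∧
    ∃ a : ℕ → ℂ, ∀ τ : ℍ,
      HasSum (fun r : ℕ => a r * Complex.exp (2 * Real.pi * Complex.I * r * (τ : ℂ))) (A τ)

/-- Singular functions. The number `N` bounds the order of all poles, uniformly in `τ`, and
`A n` is the Laurent coefficient of `z ^ (n - N)` at `z = 0`. -/
structure IsSingular (f : Fun2) : Prop where
  periodic_z : ∀ τ : ℍ, ∀ z ∉ lattice τ, f τ (z + 1) = f τ z
  periodic_tau : ∀ τ : ℍ, ∀ z ∉ lattice τ, f ((1 : ℝ) +ᵥ τ) z = f τ z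
  holomorphic_off : ∀ τ : ℍ, ∀ z ∉ lattice τ, DifferentiableAt ℂ (f τ) z
  poles : ∃ N : ℕ,
    (∀ τ : ℍ, ∀ w ∈ lattice τ,
      MeromorphicAt (f τ) w ∧ ((-(N : ℤ) : ℤ) : WithTop ℤ) ≤ meromorphicOrderAt (f τ) w) ∧
    ∃ A : ℕ → ℍ → ℂ, (∀ n, HolomorphicWithCusp (A n)) ∧
      ∀ τ : ℍ, ∀ᶠ z in nhdsWithin (0 : ℂ) {0}ᶜ,
        HasSum (fun n : ℕ => A n τ * z ^ ((n : ℤ) - (N : ℤ))) (f τ z)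

/-- `J(A)(τ, z) = cτ + d`, for `A = (g, (lam, mu))`. -/
def cocycleJ (g : SL(2, ℤ)) (τ : ℍ) : ℂ := (g 1 0 : ℂ) * (τ : ℂ) + (g 1 1 : ℂ)

/-- `X(A)(τ, z) = c / (cτ + d)`. -/
def cocycleX (g : SL(2, ℤ)) (τ : ℍ) : ℂ := (g 1 0 : ℂ) / cocycleJ g τ

/-- `Y(A)(τ, z) = (cz + c mu - d lam) / (cτ + d)`. -/
def cocycleY (g : SL(2, ℤ)) (lam mu : ℤ) (τ : ℍ) (z : ℂ) : ℂ :=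
  ((g 1 0 : ℂ) * z + (g 1 0 : ℂ) * (mu : ℂ) - (g 1 1 : ℂ) * (lam : ℂ)) / cocycleJ g τ

/-- The weight `k`, index `0` action of `(g, (lam, mu)) ∈ SL(2, ℤ) ⋉ ℤ²`. -/
def slash (k : ℕ) (f : Fun2) (g : SL(2, ℤ)) (lam mu : ℤ) : Fun2 := fun τ z =>
  (cocycleJ g τ ^ k)⁻¹ * f (g • τ) ((z + lam * (τ : ℂ) + mu) / cocycleJ g τ)

/-- Singular Jacobi forms of index zero and weight `k`. -/
def IsSingularJacobi (k : ℕ) (f : Fun2) : Prop :=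
  IsSingular f ∧ ∀ (g : SL(2, ℤ)) (lam mu : ℤ) (τ : ℍ), ∀ z ∉ lattice τ,
    slash k f g lam mu τ z = f τ z

/-- Singular quasi-Jacobi forms of index zero, weight `k` and depths at most `s₁`, `s₂`. -/
def IsQuasiJacobi (k s₁ s₂ : ℕ) (f : Fun2) : Prop :=
  IsSingular f ∧ ∃ F : Fin (s₁ + 1) → Fin (s₂ + 1) → Fun2,
    (∀ j₁ j₂, IsSingular (F j₁ j₂)) ∧
    ∀ (g : SL(2, ℤ)) (lam mu : ℤ) (τ : ℍ), ∀ z ∉ lattice τ,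
      slash k f g lam mu τ z =
        ∑ j₁, ∑ j₂, F j₁ j₂ τ z * cocycleX g τ ^ (j₁ : ℕ) * cocycleY g lam mu τ z ^ (j₂ : ℕ)

/-- The algebra of singular Jacobi forms of index zero: finite sums of forms of various weights. -/
def MemJS (F : Fun2) : Prop :=
  ∃ (K : Finset ℕ) (f : ℕ → Fun2), (∀ k ∈ K, IsSingularJacobi k (f k)) ∧
    ∀ τ : ℍ, ∀ z ∉ lattice τ, F τ z = ∑ k ∈ K, f k τ z

/-- The weight 2 Eisenstein series `e₂(τ) = (π² / 3) (1 - 24 ∑_{n ≥ 1} σ₁(n) exp(2πinτ))`. -/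
def e₂ (τ : ℍ) : ℂ :=
  (Real.pi : ℂ) ^ 2 / 3 *
    (1 - 24 * ∑' n : ℕ+, (σ 1 (n : ℕ) : ℂ) *
      Complex.exp (2 * Real.pi * Complex.I * (n : ℕ) * (τ : ℂ)))

/-- The first shifted Eisenstein function
`E₁(τ, z) = lim_N ∑_{n = -N}^{N} lim_M ∑_{m = -M}^{M} 1 / (z + m + nτ)`. -/
def E₁ : Fun2 := fun τ z =>
  ∑'[SummationFilter.symmetricIcc ℤ] n : ℤ, ∑'[SummationFilter.symmetricIcc ℤ] m : ℤ,
    1 / (z + (m : ℂ) + (n : ℂ) * (τ : ℂ))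

/-- The function `t ↦ f(t, z)` of a complex variable `t` (meaningful for `Im t > 0`). -/
def tauSlice (f : Fun2) (z : ℂ) : ℂ → ℂ := fun t => f (ofComplex t) z

/-- `∂_z = ∂ / ∂z`. -/
def dz (f : Fun2) : Fun2 := fun τ z => deriv (f τ) z

/-- The modular derivation `∂_τ = (π / 2i) ∂ / ∂τ`. -/
def dtau (f : Fun2) : Fun2 := fun τ z =>
  (Real.pi : ℂ) / (2 * Complex.I) * deriv (tauSlice f z) (τ : ℂ)

/-- The Oberdieck derivation on forms of weight `k`. -/
def oberdieck (k : ℕ) (f : Fun2) : Fun2 := fun τ z =>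
  4 * dtau f τ z + E₁ τ z * dz f τ z - (k : ℂ) * e₂ τ * f τ z

end QuasiJacobi

end

noncomputable section

namespace QuasiJacobi

open UpperHalfPlane Filter Topology
open scoped Manifold MatrixGroups ArithmeticFunction.sigma

/-! The proof has two halves: an equivariance of the derivation, and a structure theorem that makes
the derivation act on singular functions at all.

Equivariance (`slash_oberdieck`). Differentiating `f|_k A` in `τ` produces error terms in `-Y ∂_z f`
and `-k X f`. Since `4 ∂_τ` is `-2πi ∂/∂τ`, they are matched exactly by the anomalies `2πi Y` of
`E₁` (`E₁deriv_zero_slash`) and `-2πi X` of `e₂` (`e₂_smul`), so `Ob*(f)|_{k+2} A = Ob*(f|_k A)`.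
For a Jacobi form the right side is `Ob*(f)`. For a quasi-Jacobi form it is `Ob*` of a polynomial in
`X` and `Y`; as `∂X/∂τ = -X²`, `∂Y/∂τ = -XY`, `∂Y/∂z = X`, the degree in `X` grows by at most one
and the degree in `Y` does not grow.

Structure. Singularity only controls the dependence on `τ` through the Laurent coefficients at `z =
0`. It yields neither differentiability in `τ` at a fixed `z` nor singularity of the derivative.
Both come from showing that every component of a quasi-Jacobi form is a polynomial in `E₁` and its
`z`-derivatives over functions with a cusp expansion (`IsQuasiJacobi.exists_isEisPoly`). Under `z ↦
z + τ` the components transform like the coefficients of a polynomial under `Y ↦ Y - 1`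
(`finPoly_component_add_tau`). As `E₁ / (2πi)` drops by one along `τ`, translating back by it gives
elliptic functions (`isEisPoly_of_translation`). Their poles are removed one order at a time by
derivatives of `E₁`, until Liouville's theorem applies (`isEisPoly_of_quasiperiodic`). This ring is
stable under `∂/∂z`, and under `∂/∂τ` by the heat equation for `E₁` (`heat_equation`). -/

/-! ### The nome and Fourier expansions at the cusp. -/

/-- The nome `exp (2πiz)`. -/
def nome (z : ℂ) : ℂ := Complex.exp (2 * Real.pi * Complex.I * z)

lemma nome_ne_zero (z : ℂ) : nome z ≠ 0 := Complex.exp_ne_zero _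

lemma nome_add (z w : ℂ) : nome (z + w) = nome z * nome w := by
  simp [nome, mul_add, Complex.exp_add]

@[simp] lemma nome_intCast (n : ℤ) : nome n = 1 := by
  rw [nome, Complex.exp_eq_one_iff]; exact ⟨n, by ring⟩

@[simp] lemma nome_one : nome 1 = 1 := by simpa using nome_intCast 1

lemma nome_eq_one_iff {z : ℂ} : nome z = 1 ↔ ∃ n : ℤ, z = n := by
  rw [nome, Complex.exp_eq_one_iff]
  refine exists_congr fun n => ?_
  have : (2 * Real.pi * Complex.I : ℂ) ≠ 0 := Complex.two_pi_I_ne_zero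
  rw [mul_comm (n : ℂ)]
  exact mul_right_inj' this

lemma nome_nat_mul (n : ℕ) (z : ℂ) : nome (n * z) = nome z ^ n := by
  rw [nome, nome, ← Complex.exp_nat_mul]; ring_nf

lemma norm_nome (z : ℂ) : ‖nome z‖ = Real.exp (-(2 * Real.pi * z.im)) := by
  rw [nome, Complex.norm_exp]; simp

lemma norm_nome_lt_one (τ : ℍ) : ‖nome τ‖ < 1 := by
  rw [norm_nome, Real.exp_lt_one_iff]
  have := mul_pos Real.two_pi_pos τ.im_pos
  simp only [coe_im]; linarith

lemma hasDerivAt_nome (z : ℂ) :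
    HasDerivAt nome (2 * Real.pi * Complex.I * nome z) z := by
  have h := ((hasDerivAt_id z).const_mul (2 * Real.pi * Complex.I : ℂ)).cexp
  rw [mul_one, mul_comm (Complex.exp _)] at h
  exact h

lemma exists_nome_eq {q : ℂ} (h0 : q ≠ 0) (h1 : ‖q‖ < 1) : ∃ τ : ℍ, nome τ = q := by
  have h2 : (2 * Real.pi * Complex.I : ℂ) ≠ 0 := Complex.two_pi_I_ne_zero
  have key : nome (Complex.log q / (2 * Real.pi * Complex.I)) = q := by
    rw [nome, mul_div_cancel₀ _ h2, Complex.exp_log h0]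
  refine ⟨⟨Complex.log q / (2 * Real.pi * Complex.I), ?_⟩, key⟩
  have h3 := norm_nome (Complex.log q / (2 * Real.pi * Complex.I))
  rw [key] at h3
  rw [h3, Real.exp_lt_one_iff] at h1
  have := Real.two_pi_pos
  by_contra h
  push Not at h
  nlinarith

/-- In the variable `q = exp (2πiτ)` the condition becomes holomorphy on the whole unit disc, cusp
included. Closure under sums, products and differentiation is then immediate. -/
lemma holomorphicWithCusp_iff {A : ℍ → ℂ} : HolomorphicWithCusp A ↔
    ∃ Q : ℂ → ℂ, DifferentiableOn ℂ Q (Metric.ball 0 1) ∧ ∀ τ : ℍ, A τ = Q (nome τ) := by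
  have hterm (τ : ℍ) (r : ℕ) :
      Complex.exp (2 * Real.pi * Complex.I * r * (τ : ℂ)) = nome τ ^ r := by
    rw [← nome_nat_mul, nome]; ring_nf
  constructor
  · rintro ⟨-, a, ha⟩
    simp only [hterm] at ha
    -- Every `q` with `0 < |q| < 1` is a nome, so the Fourier expansion converges at points of every
    -- modulus below 1.
    have hrad : 1 ≤ (FormalMultilinearSeries.ofScalars ℂ a).radius := by
      refine ENNReal.le_of_forall_nnreal_lt fun r hr => ?_
      have hr1 : r < 1 := by exact_mod_cast hr
      rcases eq_or_ne r 0 with rfl | h0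
      · simp
      obtain ⟨τ, hτ⟩ := exists_nome_eq (q := (r : ℝ)) (by simpa using h0) (by simpa using hr1)
      refine FormalMultilinearSeries.le_radius_of_summable _ ?_
      have := (ha τ).summable.norm
      simp only [hτ, norm_mul, norm_pow] at this
      simpa [FormalMultilinearSeries.ofScalars_norm] using this
    have hfp := (FormalMultilinearSeries.ofScalars ℂ a).hasFPowerSeriesOnBall
      (lt_of_lt_of_le one_pos hrad)
    refine ⟨(FormalMultilinearSeries.ofScalars ℂ a).sum, ?_, fun τ => ?_⟩
    · refine (hfp.differentiableOn).mono ?_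
      intro x hx
      rw [Metric.mem_eball]
      refine lt_of_lt_of_le ?_ hrad
      rw [edist_dist]
      exact ENNReal.ofReal_lt_one.2 hx
    · rw [← (ha τ).tsum_eq, FormalMultilinearSeries.sum]
      refine tsum_congr fun n => ?_
      simp [mul_comm]
  · rintro ⟨Q, hQ, hA⟩
    constructor
    · rw [UpperHalfPlane.mdifferentiable_iff]
      have : DifferentiableOn ℂ (Q ∘ nome) {z | 0 < z.im} := by
        refine hQ.comp (fun z _ => (hasDerivAt_nome z).differentiableAt.differentiableWithinAt) ?_
        intro z hz
        simpa using norm_nome_lt_one ⟨z, hz⟩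
      refine this.congr fun z hz => ?_
      simp [hA, ofComplex_apply_of_im_pos hz]
    · refine ⟨fun n => (n.factorial : ℂ)⁻¹ * iteratedDeriv n Q 0, fun τ => ?_⟩
      simp only [hA]
      have := Complex.hasSum_taylorSeries_on_ball (r := 1) (by simpa using hQ)
        (z := nome τ) (by simpa using norm_nome_lt_one τ)
      refine this.congr_fun fun n => ?_
      rw [hterm]
      simp only [smul_eq_mul, sub_zero]
      ring

lemma HolomorphicWithCusp.const (c : ℂ) : HolomorphicWithCusp fun _ => c :=
  holomorphicWithCusp_iff.2 ⟨fun _ => c, differentiableOn_const c, fun _ => rfl⟩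

lemma HolomorphicWithCusp.add {A B : ℍ → ℂ} (hA : HolomorphicWithCusp A)
    (hB : HolomorphicWithCusp B) : HolomorphicWithCusp fun τ => A τ + B τ := by
  obtain ⟨P, hP, h⟩ := holomorphicWithCusp_iff.1 hA
  obtain ⟨Q, hQ, h'⟩ := holomorphicWithCusp_iff.1 hB
  exact holomorphicWithCusp_iff.2 ⟨fun q => P q + Q q, hP.add hQ, fun τ => by rw [h, h']⟩

lemma HolomorphicWithCusp.mul {A B : ℍ → ℂ} (hA : HolomorphicWithCusp A)
    (hB : HolomorphicWithCusp B) : HolomorphicWithCusp fun τ => A τ * B τ := by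
  obtain ⟨P, hP, h⟩ := holomorphicWithCusp_iff.1 hA
  obtain ⟨Q, hQ, h'⟩ := holomorphicWithCusp_iff.1 hB
  exact holomorphicWithCusp_iff.2 ⟨fun q => P q * Q q, hP.mul hQ, fun τ => by rw [h, h']⟩

lemma HolomorphicWithCusp.sum {ι : Type*} (s : Finset ι) {A : ι → ℍ → ℂ}
    (hA : ∀ i ∈ s, HolomorphicWithCusp (A i)) : HolomorphicWithCusp fun τ => ∑ i ∈ s, A i τ := by
  classical
  induction s using Finset.induction_on with
  | empty => simpa using HolomorphicWithCusp.const 0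
  | insert i s hi ih =>
    simp only [Finset.sum_insert hi]
    exact (hA i (by simp)).add (ih fun j hj => hA j (by simp [hj]))

lemma HolomorphicWithCusp.vadd_one {A : ℍ → ℂ} (hA : HolomorphicWithCusp A) (τ : ℍ) :
    A ((1 : ℝ) +ᵥ τ) = A τ := by
  obtain ⟨Q, -, h⟩ := holomorphicWithCusp_iff.1 hA
  simp [h, nome_add]

/-- The `τ`-derivative of a function with a cusp expansion has a cusp expansion. -/
lemma HolomorphicWithCusp.exists_hasDerivAt {A : ℍ → ℂ} (hA : HolomorphicWithCusp A) :
    ∃ B : ℍ → ℂ, HolomorphicWithCusp B ∧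
      ∀ τ : ℍ, HasDerivAt (fun t => A (ofComplex t)) (B τ) (τ : ℂ) := by
  obtain ⟨Q, hQ, h⟩ := holomorphicWithCusp_iff.1 hA
  refine ⟨fun τ => deriv Q (nome τ) * (2 * Real.pi * Complex.I * nome τ),
    holomorphicWithCusp_iff.2 ⟨fun q => deriv Q q * (2 * Real.pi * Complex.I * q), ?_,
      fun τ => rfl⟩, fun τ => ?_⟩
  · exact (hQ.deriv Metric.isOpen_ball).mul (by fun_prop)
  · have h1 : HasDerivAt Q (deriv Q (nome τ)) (nome τ) :=
      (hQ.differentiableAt (Metric.isOpen_ball.mem_nhds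
        (by simpa using norm_nome_lt_one τ))).hasDerivAt
    refine (h1.comp (τ : ℂ) (hasDerivAt_nome τ)).congr_of_eventuallyEq ?_
    filter_upwards [isOpen_upperHalfPlaneSet.mem_nhds τ.2] with t ht
    simp [h, ofComplex_apply_of_im_pos ht]

/-! ### The lattice -/

/-- The real coordinates in the basis `1, τ` are jointly continuous in `(τ, z)`; integrality of both
is a closed condition. -/
lemma mem_lattice_iff {τ : ℍ} {z : ℂ} : z ∈ lattice τ ↔
    (∃ n : ℤ, (z.im / τ.im : ℝ) = n) ∧ ∃ m : ℤ, z.re - z.im / τ.im * τ.re = m := by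
  have h0 : τ.im ≠ 0 := τ.im_ne_zero
  constructor
  · rintro ⟨m, n, rfl⟩
    have : ((m + n * (τ : ℂ)).im / τ.im : ℝ) = n := by simp [h0]
    refine ⟨⟨n, this⟩, m, ?_⟩
    rw [this]; simp
  · rintro ⟨⟨n, hn⟩, m, hm⟩
    rw [hn] at hm
    rw [div_eq_iff h0] at hn
    refine ⟨m, n, Complex.ext ?_ ?_⟩
    · simp [← hm]
    · simp [hn]

lemma add_mem_lattice {τ : ℍ} {z w : ℂ} (hz : z ∈ lattice τ) (hw : w ∈ lattice τ) :
    z + w ∈ lattice τ := by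
  obtain ⟨m, n, rfl⟩ := hz
  obtain ⟨m', n', rfl⟩ := hw
  exact ⟨m + m', n + n', by push_cast; ring⟩

@[simp] lemma neg_mem_lattice {τ : ℍ} {z : ℂ} : -z ∈ lattice τ ↔ z ∈ lattice τ := by
  constructor <;>
  · rintro ⟨m, n, h⟩
    exact ⟨-m, -n, by push_cast; linear_combination -h⟩

lemma add_mem_lattice_iff {τ : ℍ} {z w : ℂ} (hw : w ∈ lattice τ) :
    z + w ∈ lattice τ ↔ z ∈ lattice τ :=
  ⟨fun h => by simpa using add_mem_lattice h (neg_mem_lattice.2 hw), fun h => add_mem_lattice h hw⟩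

lemma period_mem_lattice (τ : ℍ) (lam mu : ℤ) : lam * (τ : ℂ) + mu ∈ lattice τ :=
  ⟨mu, lam, add_comm _ _⟩

@[simp] lemma add_period_mem_lattice {τ : ℍ} {z : ℂ} (lam mu : ℤ) :
    z + lam * (τ : ℂ) + mu ∈ lattice τ ↔ z ∈ lattice τ := by
  rw [add_assoc]; exact add_mem_lattice_iff (period_mem_lattice τ lam mu)

@[simp] lemma add_one_mem_lattice {τ : ℍ} {z : ℂ} : z + 1 ∈ lattice τ ↔ z ∈ lattice τ := by
  simpa using add_period_mem_lattice (τ := τ) (z := z) 0 1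

@[simp] lemma add_tau_mem_lattice {τ : ℍ} {z : ℂ} : z + τ ∈ lattice τ ↔ z ∈ lattice τ := by
  simpa using add_period_mem_lattice (τ := τ) (z := z) 1 0

@[simp] lemma lattice_vadd_one (τ : ℍ) : lattice ((1 : ℝ) +ᵥ τ) = lattice τ := by
  ext z
  constructor
  · rintro ⟨m, n, h⟩
    exact ⟨m + n, n, by rw [h]; push_cast; simp; ring⟩
  · rintro ⟨m, n, h⟩
    exact ⟨m - n, n, by rw [h]; push_cast; simp; ring⟩

/-- Joint openness is needed because a derivative in `τ` at fixed `z` sees the lattice move. -/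
lemma isOpen_off_lattice : IsOpen {p : ℍ × ℂ | p.2 ∉ lattice p.1} := by
  have hcl : IsClosed {p : ℍ × ℂ | p.2 ∈ lattice p.1} := by
    have hZ : IsClosed (Set.range ((↑) : ℤ → ℝ)) := Int.isClosedEmbedding_coe_real.isClosed_range
    have hc : Continuous fun p : ℍ × ℂ => p.2.im / p.1.im :=
      (Complex.continuous_im.comp continuous_snd).div
        (UpperHalfPlane.continuous_im.comp continuous_fst) fun p => p.1.im_ne_zero
    have hc' : Continuous fun p : ℍ × ℂ => p.2.re - p.2.im / p.1.im * p.1.re :=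
      (Complex.continuous_re.comp continuous_snd).sub
        (hc.mul (UpperHalfPlane.continuous_re.comp continuous_fst))
    convert (hZ.preimage hc).inter (hZ.preimage hc') using 1
    ext p
    simp only [Set.mem_ofPred_eq, mem_lattice_iff, Set.mem_inter_iff, Set.mem_preimage,
      Set.mem_range, eq_comm]
  simpa [Set.compl_ofPred] using hcl.isOpen_compl

lemma isOpen_off_lattice_right (τ : ℍ) : IsOpen {z : ℂ | z ∉ lattice τ} :=
  isOpen_off_lattice.preimage (f := fun z : ℂ => (τ, z)) (by fun_prop)

lemma eventually_off_lattice {τ : ℍ} {z : ℂ} (hz : z ∉ lattice τ) :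
    ∀ᶠ p : ℂ × ℂ in 𝓝 ((τ : ℂ), z), 0 < p.1.im ∧ p.2 ∉ lattice (ofComplex p.1) := by
  have h1 : ContinuousAt (fun p : ℂ × ℂ => (ofComplex p.1, p.2)) ((τ : ℂ), z) := by
    refine ContinuousAt.prodMk ?_ continuousAt_snd
    exact ContinuousAt.comp (f := Prod.fst) (g := ofComplex)
      (contMDiffAt_ofComplex (n := 0) τ.2).continuousAt continuousAt_fst
  refine Filter.Eventually.and ?_ ?_
  · exact (isOpen_upperHalfPlaneSet.preimage continuous_fst).mem_nhds τ.2
  · refine h1.eventually (isOpen_off_lattice.mem_nhds ?_)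
    simpa using hz

lemma eventually_tau_off_lattice {τ : ℍ} {z : ℂ} (hz : z ∉ lattice τ) :
    ∀ᶠ t : ℂ in 𝓝 (τ : ℂ), 0 < t.im ∧ z ∉ lattice (ofComplex t) :=
  (Continuous.continuousAt (f := fun t : ℂ => (t, z)) (by fun_prop)).eventually
    (eventually_off_lattice hz)

lemma eventually_z_off_lattice {τ : ℍ} {z : ℂ} (hz : z ∉ lattice τ) :
    ∀ᶠ x in 𝓝 z, x ∉ lattice τ := (isOpen_off_lattice_right τ).mem_nhds hz

lemma eventually_punctured_off_lattice (τ : ℍ) (w : ℂ) : ∀ᶠ z in 𝓝[≠] w, z ∉ lattice τ := by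
  by_cases hw : w ∈ lattice τ
  swap
  · exact nhdsWithin_le_nhds (eventually_z_off_lattice hw)
  have h0 : τ.im ≠ 0 := τ.im_ne_zero
  have hc : Continuous fun z : ℂ => z.im / τ.im := Complex.continuous_im.div_const _
  have hc' : Continuous fun z : ℂ => z.re - z.im / τ.im * τ.re :=
    Complex.continuous_re.sub (hc.mul continuous_const)
  have h1 := hc.continuousAt.eventually (Metric.ball_mem_nhds (w.im / τ.im) one_pos)
  have h2 := hc'.continuousAt.eventually
    (Metric.ball_mem_nhds (w.re - w.im / τ.im * τ.re) one_pos)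
  filter_upwards [nhdsWithin_le_nhds h1, nhdsWithin_le_nhds h2, self_mem_nhdsWithin]
    with z h1 h2 hne hz
  obtain ⟨⟨n, hn⟩, m, hm⟩ := mem_lattice_iff.1 hz
  obtain ⟨⟨n', hn'⟩, m', hm'⟩ := mem_lattice_iff.1 hw
  rw [hn, hn', Real.dist_eq, ← Int.cast_sub, ← Int.cast_abs] at h1
  rw [hm, hm', Real.dist_eq, ← Int.cast_sub, ← Int.cast_abs] at h2
  have e1 : n = n' := by
    have : |n - n'| < 1 := by exact_mod_cast h1
    rw [Int.abs_lt_one_iff] at this; linarith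
  have e2 : m = m' := by
    have : |m - m'| < 1 := by exact_mod_cast h2
    rw [Int.abs_lt_one_iff] at this; linarith
  subst e1 e2
  have e3 : z.im = w.im := by
    have := hn.trans hn'.symm
    field_simp at this; exact this
  apply hne
  refine Complex.ext ?_ e3
  rw [e3] at hm
  linarith

/-! ### Poles of bounded order -/

/-- `f` is near `w` a meromorphic function with a pole of order at most `N` at `w`. -/
def HasPoleOrderLE (N : ℕ) (f : ℂ → ℂ) (w : ℂ) : Prop :=
  ∃ h : ℂ → ℂ, AnalyticAt ℂ h w ∧ ∀ᶠ z in 𝓝[≠] w, (z - w) ^ N * f z = h z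

/-- Clearing the denominator `(z - w) ^ N` replaces arithmetic of orders by arithmetic of analytic
functions. -/
lemma hasPoleOrderLE_iff {N : ℕ} {f : ℂ → ℂ} {w : ℂ} : HasPoleOrderLE N f w ↔
    MeromorphicAt f w ∧ ((-(N : ℤ) : ℤ) : WithTop ℤ) ≤ meromorphicOrderAt f w := by
  have hp : MeromorphicAt (fun z : ℂ => (z - w) ^ N) w := by fun_prop
  have hmul (hf : MeromorphicAt f w) :
      meromorphicOrderAt (fun z => (z - w) ^ N * f z) w = N + meromorphicOrderAt f w := by
    refine (meromorphicOrderAt_mul hp hf).trans ?_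
    congr 1
    exact_mod_cast meromorphicOrderAt_pow_id_sub_const (𝕜 := ℂ) (x := w) (n := N)
  have hle (hf : MeromorphicAt f w) :
      ((-(N : ℤ) : ℤ) : WithTop ℤ) ≤ meromorphicOrderAt f w ↔
        0 ≤ meromorphicOrderAt (fun z => (z - w) ^ N * f z) w := by
    rw [hmul hf]
    cases h : meromorphicOrderAt f w with
    | top => simp
    | coe n =>
      norm_cast
      constructor <;> intro <;> omega
  constructor
  · rintro ⟨h, hh, hf⟩
    have hmf : MeromorphicAt f w := by
      have : MeromorphicAt (fun z => ((z - w) ^ N)⁻¹ * h z) w := hp.inv.mul hh.meromorphicAt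
      refine this.congr ?_
      filter_upwards [hf, self_mem_nhdsWithin] with z hz hne
      rw [← hz, inv_mul_cancel_left₀ (pow_ne_zero _ (sub_ne_zero.2 hne))]
    refine ⟨hmf, (hle hmf).2 ?_⟩
    exact (hp.mul hmf).meromorphicOrderAt_nonneg_iff.2 ⟨h, hh, hf⟩
  · rintro ⟨hmf, ho⟩
    exact (hp.mul hmf).meromorphicOrderAt_nonneg_iff.1 ((hle hmf).1 ho)

namespace HasPoleOrderLE

variable {N M : ℕ} {f g : ℂ → ℂ} {w : ℂ}

lemma of_analyticAt (h : AnalyticAt ℂ f w) : HasPoleOrderLE 0 f w :=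
  ⟨f, h, by simp⟩

lemma congr (hf : HasPoleOrderLE N f w) (h : ∀ᶠ z in 𝓝[≠] w, g z = f z) :
    HasPoleOrderLE N g w := by
  obtain ⟨u, hu, e⟩ := hf
  exact ⟨u, hu, by filter_upwards [h, e] with z h e; rw [h, e]⟩

lemma mono (hf : HasPoleOrderLE N f w) (h : N ≤ M) : HasPoleOrderLE M f w := by
  obtain ⟨u, hu, e⟩ := hf
  refine ⟨fun z => (z - w) ^ (M - N) * u z, by fun_prop, ?_⟩
  filter_upwards [e] with z e
  rw [← e, ← mul_assoc, ← pow_add, Nat.sub_add_cancel h]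

lemma add (hf : HasPoleOrderLE N f w) (hg : HasPoleOrderLE N g w) :
    HasPoleOrderLE N (fun z => f z + g z) w := by
  obtain ⟨u, hu, e⟩ := hf
  obtain ⟨v, hv, e'⟩ := hg
  refine ⟨fun z => u z + v z, by fun_prop, ?_⟩
  filter_upwards [e, e'] with z e e'
  rw [mul_add, e, e']

lemma mul (hf : HasPoleOrderLE N f w) (hg : HasPoleOrderLE M g w) :
    HasPoleOrderLE (N + M) (fun z => f z * g z) w := by
  obtain ⟨u, hu, e⟩ := hf
  obtain ⟨v, hv, e'⟩ := hg
  refine ⟨fun z => u z * v z, by fun_prop, ?_⟩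
  filter_upwards [e, e'] with z e e'
  rw [← e, ← e']; ring

lemma deriv (hf : HasPoleOrderLE N f w) : HasPoleOrderLE (N + 1) (deriv f) w := by
  obtain ⟨u, hu, e⟩ := hf
  refine ⟨fun z => (z - w) * _root_.deriv u z - N * u z,
    (((by fun_prop : AnalyticAt ℂ (fun z : ℂ => z - w) w)).mul hu.deriv).sub
      (analyticAt_const.mul hu), ?_⟩
  filter_upwards [eventually_eventually_nhdsWithin.2 e, self_mem_nhdsWithin,
    nhdsWithin_le_nhds hu.eventually_analyticAt] with z hz hne hun
  have hzw : z - w ≠ 0 := sub_ne_zero.2 hne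
  have hz' : ∀ᶠ x in 𝓝 z, f x = ((x - w) ^ N)⁻¹ * u x := by
    have h1 : ∀ᶠ x in 𝓝 z, x ≠ w := isOpen_ne.mem_nhds hne
    have h2 : ∀ᶠ x in 𝓝 z, (x - w) ^ N * f x = u x := by
      rwa [IsOpen.nhdsWithin_eq isOpen_compl_singleton hne] at hz
    filter_upwards [h1, h2] with x h1 h2
    rw [← h2, inv_mul_cancel_left₀ (pow_ne_zero _ (sub_ne_zero.2 h1))]
  have hd : HasDerivAt (fun x => (x - w) ^ N) (N * (z - w) ^ (N - 1) * 1) z :=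
    ((hasDerivAt_id z).sub_const w).pow N
  have hdf := ((hd.inv (pow_ne_zero _ hzw)).mul
    hun.differentiableAt.hasDerivAt).congr_of_eventuallyEq hz'
  rw [hdf.deriv]
  rcases N with _ | N
  · simp
  · simp only [Nat.add_sub_cancel, Pi.inv_apply]
    field_simp
    ring

end HasPoleOrderLE

/-! ### Taylor coefficients with cusp expansions -/

/-- The Taylor coefficients at `z = 0` are holomorphic in `τ` with a Fourier expansion. -/
def HasCuspTaylor (g : Fun2) : Prop :=
  (∀ τ, AnalyticAt ℂ (g τ) 0) ∧
    ∀ n : ℕ, HolomorphicWithCusp fun τ => iteratedDeriv n (g τ) 0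

namespace HasCuspTaylor

variable {f g : Fun2}

lemma add (hf : HasCuspTaylor f) (hg : HasCuspTaylor g) :
    HasCuspTaylor fun τ z => f τ z + g τ z := by
  refine ⟨fun τ => (hf.1 τ).add (hg.1 τ), fun n => ?_⟩
  simp only [iteratedDeriv_fun_add (hf.1 _).contDiffAt (hg.1 _).contDiffAt]
  exact (hf.2 n).add (hg.2 n)

lemma mul (hf : HasCuspTaylor f) (hg : HasCuspTaylor g) :
    HasCuspTaylor fun τ z => f τ z * g τ z := by
  refine ⟨fun τ => (hf.1 τ).mul (hg.1 τ), fun n => ?_⟩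
  simp only [iteratedDeriv_fun_mul (hf.1 _).contDiffAt (hg.1 _).contDiffAt]
  exact HolomorphicWithCusp.sum _ fun i _ => ((HolomorphicWithCusp.const _).mul (hf.2 _)).mul
    (hg.2 _)

lemma coeff {A : ℍ → ℂ} (hA : HolomorphicWithCusp A) : HasCuspTaylor fun τ _ => A τ := by
  refine ⟨fun τ => analyticAt_const, fun n => ?_⟩
  simp only [iteratedDeriv_const]
  split_ifs
  · exact hA
  · exact HolomorphicWithCusp.const 0

lemma of_analyticAt {φ : ℂ → ℂ} (h : AnalyticAt ℂ φ 0) : HasCuspTaylor fun _ => φ :=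
  ⟨fun _ => h, fun _ => HolomorphicWithCusp.const _⟩

lemma pow_mul (n : ℕ) (hf : HasCuspTaylor f) : HasCuspTaylor fun τ z => z ^ n * f τ z :=
  (of_analyticAt (φ := fun z => z ^ n) (by fun_prop)).mul hf

lemma const_mul (c : ℂ) (hf : HasCuspTaylor f) : HasCuspTaylor fun τ z => c * f τ z :=
  (coeff (HolomorphicWithCusp.const c)).mul hf

lemma sub (hf : HasCuspTaylor f) (hg : HasCuspTaylor g) :
    HasCuspTaylor fun τ z => f τ z - g τ z := by
  simpa [sub_eq_add_neg] using hf.add (hg.const_mul (-1))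

lemma deriv (hf : HasCuspTaylor f) : HasCuspTaylor fun τ => deriv (f τ) := by
  refine ⟨fun τ => (hf.1 τ).deriv, fun n => ?_⟩
  simp only [← iteratedDeriv_succ']
  exact hf.2 _

/-- A function vanishing at `z = 0` can be divided by `z`. -/
lemma exists_eq_mul (hf : HasCuspTaylor f) (h0 : ∀ τ, f τ 0 = 0) :
    ∃ g, HasCuspTaylor g ∧ ∀ τ z, f τ z = z * g τ z := by
  have han (τ : ℍ) : AnalyticAt ℂ (dslope (f τ) 0) 0 := by
    obtain ⟨p, hp⟩ := hf.1 τ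
    exact ⟨_, hp.has_fpower_series_dslope_fslope⟩
  have heq (τ : ℍ) (z : ℂ) : f τ z = z * dslope (f τ) 0 z := by
    have := sub_smul_dslope (f τ) 0 z
    simpa [h0] using this.symm
  refine ⟨fun τ => dslope (f τ) 0, ⟨han, fun n => ?_⟩, heq⟩
  -- In the Leibniz rule for `z * dslope` at `z = 0`, only the term with exactly one derivative on
  -- `z` survives.
  have key (τ : ℍ) : iteratedDeriv n (dslope (f τ) 0) 0 =
      (n + 1 : ℂ)⁻¹ * iteratedDeriv (n + 1) (f τ) 0 := by
    have e : f τ = fun z => id z * dslope (f τ) 0 z := funext (heq τ)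
    rw [e, iteratedDeriv_fun_mul (by fun_prop) (han τ).contDiffAt,
      Finset.sum_eq_single_of_mem 1 (by simp)]
    · have : (n + 1 : ℂ) ≠ 0 := by exact_mod_cast n.succ_ne_zero
      rw [← e]
      simp [iteratedDeriv_one]
      field_simp
    · intro i _ hi
      rw [iteratedDeriv_id]
      simp [hi]
  simp only [key]
  exact (HolomorphicWithCusp.const _).mul (hf.2 _)

end HasCuspTaylor

/-- The function `z ^ N * f` extends to `z = 0`, with Taylor coefficients holomorphic in `τ` with a
Fourier expansion. -/
def HasCuspLaurent (N : ℕ) (f : Fun2) : Prop :=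
  ∃ g, HasCuspTaylor g ∧ ∀ τ, ∀ᶠ z in 𝓝[≠] (0 : ℂ), z ^ N * f τ z = g τ z

/-- The Laurent coefficient `A n` is the `n`-th Taylor coefficient of `z ^ N * f`; convergence at
one nonzero `z` already gives a positive radius. -/
lemma hasCuspLaurent_iff {N : ℕ} {f : Fun2} : HasCuspLaurent N f ↔
    ∃ A : ℕ → ℍ → ℂ, (∀ n, HolomorphicWithCusp (A n)) ∧
      ∀ τ : ℍ, ∀ᶠ z in 𝓝[≠] (0 : ℂ),
        HasSum (fun n : ℕ => A n τ * z ^ ((n : ℤ) - (N : ℤ))) (f τ z) := by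
  constructor
  · rintro ⟨g, hg, h⟩
    refine ⟨fun n τ => (n.factorial : ℂ)⁻¹ * iteratedDeriv n (g τ) 0,
      fun n => (HolomorphicWithCusp.const _).mul (hg.2 n), fun τ => ?_⟩
    obtain ⟨r, hr, hball⟩ := Metric.eventually_nhds_iff_ball.1 (hg.1 τ).eventually_analyticAt
    filter_upwards [h τ, self_mem_nhdsWithin,
      nhdsWithin_le_nhds (Metric.ball_mem_nhds (0 : ℂ) hr)] with z hz hne hzr
    have hne : z ≠ 0 := hne
    have := Complex.hasSum_taylorSeries_on_ball (f := g τ) (c := 0) (r := r)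
      (fun x hx => (hball x hx).differentiableAt.differentiableWithinAt) hzr
    rw [← hz] at this
    have := this.mul_left (z ^ N)⁻¹
    rw [inv_mul_cancel_left₀ (pow_ne_zero _ hne)] at this
    refine this.congr_fun fun n => ?_
    rw [zpow_sub₀ hne, zpow_natCast, zpow_natCast, smul_eq_mul, smul_eq_mul, sub_zero]
    ring
  · rintro ⟨A, hA, h⟩
    have hsum (τ : ℍ) : ∀ᶠ z in 𝓝[≠] (0 : ℂ), HasSum (fun n : ℕ => A n τ * z ^ n)
        (z ^ N * f τ z) := by
      filter_upwards [h τ, self_mem_nhdsWithin] with z hz hne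
      have hne : z ≠ 0 := hne
      refine (hz.mul_left (z ^ N)).congr_fun fun n => ?_
      rw [zpow_sub₀ hne, zpow_natCast, zpow_natCast]
      have := pow_ne_zero N hne
      field_simp
    have hfp (τ : ℍ) : HasFPowerSeriesOnBall
        (FormalMultilinearSeries.ofScalars ℂ (fun n => A n τ)).sum
        (FormalMultilinearSeries.ofScalars ℂ (fun n => A n τ)) 0
        (FormalMultilinearSeries.ofScalars ℂ (fun n => A n τ)).radius := by
      refine FormalMultilinearSeries.hasFPowerSeriesOnBall _ ?_
      obtain ⟨z, hz, hne⟩ := ((hsum τ).and self_mem_nhdsWithin).exists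
      have hne : z ≠ 0 := hne
      refine lt_of_lt_of_le (b := (‖z‖₊ : ENNReal)) (by simpa using hne) ?_
      refine FormalMultilinearSeries.le_radius_of_summable _ ?_
      simpa [FormalMultilinearSeries.ofScalars_norm] using hz.summable.norm
    refine ⟨fun τ => (FormalMultilinearSeries.ofScalars ℂ (fun n => A n τ)).sum,
      ⟨fun τ => (hfp τ).analyticAt, fun n => ?_⟩, fun τ => ?_⟩
    · have key (τ : ℍ) : iteratedDeriv n
          (FormalMultilinearSeries.ofScalars ℂ (fun n => A n τ)).sum 0 = n.factorial * A n τ := by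
        have := (hfp τ).factorial_smul 1 n
        rw [iteratedDeriv_eq_iteratedFDeriv, ← this]
        simp
      simp only [key]
      exact (HolomorphicWithCusp.const _).mul (hA n)
    · filter_upwards [hsum τ] with z hz
      rw [← hz.tsum_eq, FormalMultilinearSeries.sum]
      exact tsum_congr fun n => by simp [mul_comm]

lemma eventually_pow_mul_deriv {N : ℕ} {f u : ℂ → ℂ}
    (e : ∀ᶠ z in 𝓝[≠] (0 : ℂ), z ^ N * f z = u z)
    (hd : ∀ᶠ z in 𝓝[≠] (0 : ℂ), DifferentiableAt ℂ f z) :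
    ∀ᶠ z in 𝓝[≠] (0 : ℂ), z ^ (N + 1) * deriv f z = z ^ 1 * deriv u z - N * u z := by
  filter_upwards [eventually_eventually_nhdsWithin.2 e, self_mem_nhdsWithin, hd]
    with z hz hne hdz
  have hne : z ≠ 0 := hne
  rw [IsOpen.nhdsWithin_eq isOpen_compl_singleton hne] at hz
  have h1 := (((hasDerivAt_id z).pow N).mul hdz.hasDerivAt).congr_of_eventuallyEq
    (hz.mono fun x hx => hx.symm)
  rw [h1.deriv, ← hz.self_of_nhds]
  rcases N with _ | N
  · simp
  · simp only [Nat.add_sub_cancel, Pi.pow_apply, id]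
    push_cast
    ring

namespace HasCuspLaurent

variable {N M : ℕ} {f g : Fun2}

lemma congr (hf : HasCuspLaurent N f) (h : ∀ τ, ∀ᶠ z in 𝓝[≠] (0 : ℂ), g τ z = f τ z) :
    HasCuspLaurent N g := by
  obtain ⟨u, hu, e⟩ := hf
  exact ⟨u, hu, fun τ => by filter_upwards [h τ, e τ] with z h e; rw [h, e]⟩

lemma of_taylor (hf : HasCuspTaylor f) : HasCuspLaurent 0 f := ⟨f, hf, by simp⟩

lemma mono (hf : HasCuspLaurent N f) (h : N ≤ M) : HasCuspLaurent M f := by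
  obtain ⟨u, hu, e⟩ := hf
  refine ⟨_, hu.pow_mul (M - N), fun τ => ?_⟩
  filter_upwards [e τ] with z e
  rw [← e, ← mul_assoc, ← pow_add, Nat.sub_add_cancel h]

lemma add (hf : HasCuspLaurent N f) (hg : HasCuspLaurent N g) :
    HasCuspLaurent N (fun τ z => f τ z + g τ z) := by
  obtain ⟨u, hu, e⟩ := hf
  obtain ⟨v, hv, e'⟩ := hg
  refine ⟨_, hu.add hv, fun τ => ?_⟩
  filter_upwards [e τ, e' τ] with z e e'
  rw [mul_add, e, e']

lemma mul (hf : HasCuspLaurent N f) (hg : HasCuspLaurent M g) :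
    HasCuspLaurent (N + M) (fun τ z => f τ z * g τ z) := by
  obtain ⟨u, hu, e⟩ := hf
  obtain ⟨v, hv, e'⟩ := hg
  refine ⟨_, hu.mul hv, fun τ => ?_⟩
  filter_upwards [e τ, e' τ] with z e e'
  rw [← e, ← e']; ring

lemma deriv (hf : HasCuspLaurent N f) (hd : ∀ τ, ∀ z ∉ lattice τ, DifferentiableAt ℂ (f τ) z) :
    HasCuspLaurent (N + 1) (dz f) := by
  obtain ⟨u, hu, e⟩ := hf
  exact ⟨_, (hu.deriv.pow_mul 1).sub (hu.const_mul N), fun τ => eventually_pow_mul_deriv (e τ)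
    ((eventually_punctured_off_lattice τ 0).mono fun z hz => hd τ z hz)⟩

end HasCuspLaurent

/-! ### The algebra of singular functions -/

lemma isSingular_iff {f : Fun2} : IsSingular f ↔
    (∀ τ : ℍ, ∀ z ∉ lattice τ, f τ (z + 1) = f τ z) ∧
    (∀ τ : ℍ, ∀ z ∉ lattice τ, f ((1 : ℝ) +ᵥ τ) z = f τ z) ∧
    (∀ τ : ℍ, ∀ z ∉ lattice τ, DifferentiableAt ℂ (f τ) z) ∧
    ∃ N : ℕ, (∀ τ : ℍ, ∀ w ∈ lattice τ, HasPoleOrderLE N (f τ) w) ∧ HasCuspLaurent N f := by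
  simp only [hasPoleOrderLE_iff, hasCuspLaurent_iff]
  exact ⟨fun h => ⟨h.1, h.2, h.3, h.4⟩, fun h => ⟨h.1, h.2.1, h.2.2.1, h.2.2.2⟩⟩

namespace IsSingular

variable {f g : Fun2}

lemma congr (hf : IsSingular f) (h : ∀ τ, ∀ z ∉ lattice τ, g τ z = f τ z) : IsSingular g := by
  obtain ⟨h1, h2, h3, N, h4, h5⟩ := isSingular_iff.1 hf
  refine isSingular_iff.2 ⟨fun τ z hz => ?_, fun τ z hz => ?_, fun τ z hz => ?_, N,
    fun τ w hw => ?_, ?_⟩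
  · rw [h τ _ (by simpa), h τ z hz, h1 τ z hz]
  · rw [h _ z (by simpa), h τ z hz, h2 τ z hz]
  · exact (h3 τ z hz).congr_of_eventuallyEq ((eventually_z_off_lattice hz).mono fun x hx => h τ x hx)
  · exact (h4 τ w hw).congr ((eventually_punctured_off_lattice τ w).mono fun x hx => h τ x hx)
  · exact h5.congr fun τ => (eventually_punctured_off_lattice τ 0).mono fun x hx => h τ x hx

lemma add (hf : IsSingular f) (hg : IsSingular g) : IsSingular fun τ z => f τ z + g τ z := by
  obtain ⟨h1, h2, h3, N, h4, h5⟩ := isSingular_iff.1 hf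
  obtain ⟨k1, k2, k3, M, k4, k5⟩ := isSingular_iff.1 hg
  refine isSingular_iff.2 ⟨fun τ z hz => ?_, fun τ z hz => ?_, fun τ z hz => ?_, max N M,
    fun τ w hw => ?_, ?_⟩
  · rw [h1 τ z hz, k1 τ z hz]
  · rw [h2 τ z hz, k2 τ z hz]
  · exact (h3 τ z hz).add (k3 τ z hz)
  · exact ((h4 τ w hw).mono (le_max_left _ _)).add ((k4 τ w hw).mono (le_max_right _ _))
  · exact (h5.mono (le_max_left _ _)).add (k5.mono (le_max_right _ _))

lemma mul (hf : IsSingular f) (hg : IsSingular g) : IsSingular fun τ z => f τ z * g τ z := by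
  obtain ⟨h1, h2, h3, N, h4, h5⟩ := isSingular_iff.1 hf
  obtain ⟨k1, k2, k3, M, k4, k5⟩ := isSingular_iff.1 hg
  refine isSingular_iff.2 ⟨fun τ z hz => ?_, fun τ z hz => ?_, fun τ z hz => ?_, N + M,
    fun τ w hw => (h4 τ w hw).mul (k4 τ w hw), h5.mul k5⟩
  · rw [h1 τ z hz, k1 τ z hz]
  · rw [h2 τ z hz, k2 τ z hz]
  · exact (h3 τ z hz).mul (k3 τ z hz)

lemma coeff {A : ℍ → ℂ} (hA : HolomorphicWithCusp A) : IsSingular fun τ _ => A τ :=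
  isSingular_iff.2 ⟨fun _ _ _ => rfl, fun τ _ _ => hA.vadd_one τ,
    fun _ _ _ => differentiableAt_const _, 0,
    fun _ _ _ => HasPoleOrderLE.of_analyticAt analyticAt_const,
    HasCuspLaurent.of_taylor (HasCuspTaylor.coeff hA)⟩

lemma dz (hf : IsSingular f) : IsSingular (dz f) := by
  obtain ⟨h1, h2, h3, N, h4, h5⟩ := isSingular_iff.1 hf
  refine isSingular_iff.2 ⟨fun τ z hz => ?_, fun τ z hz => ?_, fun τ z hz => ?_, N + 1,
    fun τ w hw => (h4 τ w hw).deriv, h5.deriv h3⟩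
  · have : (fun x => f τ (x + 1)) =ᶠ[𝓝 z] f τ :=
      (eventually_z_off_lattice hz).mono fun x hx => h1 τ x hx
    rw [QuasiJacobi.dz, QuasiJacobi.dz, ← this.deriv_eq, deriv_comp_add_const]
  · have : f ((1 : ℝ) +ᵥ τ) =ᶠ[𝓝 z] f τ :=
      (eventually_z_off_lattice hz).mono fun x hx => h2 τ x hx
    exact this.deriv_eq
  · have : DifferentiableOn ℂ (f τ) {z | z ∉ lattice τ} :=
      fun x hx => (h3 τ x hx).differentiableWithinAt
    exact (this.deriv (isOpen_off_lattice_right τ)).differentiableAt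
      ((isOpen_off_lattice_right τ).mem_nhds hz)

end IsSingular

/-! ### Series in the nome -/

/-- `P` is holomorphic away from `1` and vanishes at `0`. -/
def IsNomeKernel (P : ℂ → ℂ) : Prop := DifferentiableOn ℂ P {1}ᶜ ∧ P 0 = 0

/-- The derivation `2πi x d/dx`, which corresponds to `d/dz` for `x = exp (2πiz)`. -/
def nomeDeriv (P : ℂ → ℂ) (x : ℂ) : ℂ := deriv P x * (2 * Real.pi * Complex.I * x)

/-- The series `∑_{n ≥ 1} n ^ m P (exp (2πi(z + nt)))`. -/
def nomeSeries (m : ℕ) (P : ℂ → ℂ) (t z : ℂ) : ℂ :=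
  ∑' n : ℕ, ((n : ℂ) + 1) ^ m * P (nome (z + (n + 1) * t))

/-- The factor `x` in the derivation restores the vanishing at `0`, so all `z`-derivatives of a
series are again series of the same kind. -/
lemma IsNomeKernel.nomeDeriv {P : ℂ → ℂ} (hP : IsNomeKernel P) : IsNomeKernel (nomeDeriv P) :=
  ⟨(hP.1.deriv isOpen_compl_singleton).mul (by fun_prop), by simp [QuasiJacobi.nomeDeriv]⟩

lemma IsNomeKernel.differentiableAt {P : ℂ → ℂ} (hP : IsNomeKernel P) {x : ℂ} (hx : x ≠ 1) :
    DifferentiableAt ℂ P x := hP.1.differentiableAt (isOpen_compl_singleton.mem_nhds hx)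

lemma IsNomeKernel.hasDerivAt {P : ℂ → ℂ} (hP : IsNomeKernel P) {w : ℂ} (hw : nome w ≠ 1) :
    HasDerivAt (fun w => P (nome w)) (QuasiJacobi.nomeDeriv P (nome w)) w :=
  (hP.differentiableAt hw).hasDerivAt.comp w (hasDerivAt_nome w)

lemma IsNomeKernel.exists_bound {P : ℂ → ℂ} (hP : IsNomeKernel P) :
    ∃ C > 0, ∃ δ > 0, ∀ x, ‖x‖ < δ → ‖P x‖ ≤ C * ‖x‖ := by
  obtain ⟨C, hC, h⟩ := (hP.differentiableAt zero_ne_one).isBigO_sub.exists_pos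
  obtain ⟨δ, hδ, h⟩ := Metric.eventually_nhds_iff_ball.1 h.bound
  exact ⟨C, hC, δ, hδ, fun x hx => by simpa [hP.2] using h x (by simpa using hx)⟩

lemma norm_nome_add_mul_le {y Y : ℝ} {t z : ℂ} (ht : y ≤ t.im) (hz : -Y ≤ z.im) (n : ℕ) :
    ‖nome (z + (n + 1) * t)‖ ≤
      Real.exp (2 * Real.pi * Y) * Real.exp (-(2 * Real.pi * y)) ^ (n + 1) := by
  rw [norm_nome, ← Real.exp_nat_mul, ← Real.exp_add, Real.exp_le_exp]
  have h1 : (z + ((n : ℂ) + 1) * t).im = z.im + (n + 1) * t.im := by simp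
  rw [h1]
  have h2 : ((n : ℝ) + 1) * y ≤ (n + 1) * t.im := by gcongr
  have := Real.two_pi_pos
  push_cast
  nlinarith

/-- A uniform bound for the tail of the series. -/
lemma IsNomeKernel.exists_tail_bound {P : ℂ → ℂ} (hP : IsNomeKernel P) {y : ℝ} (hy : 0 < y)
    (Y : ℝ) : ∃ C : ℝ, ∃ ρ : ℝ, 0 < ρ ∧ ρ < 1 ∧ ∃ M : ℕ, ∀ n ≥ M, ∀ t z : ℂ, y ≤ t.im → -Y ≤ z.im →
      nome (z + (n + 1) * t) ≠ 1 ∧ ‖P (nome (z + (n + 1) * t))‖ ≤ C * ρ ^ n := by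
  obtain ⟨C, hC, δ, hδ, hb⟩ := hP.exists_bound
  set K := Real.exp (2 * Real.pi * Y)
  set ρ := Real.exp (-(2 * Real.pi * y)) with hρ
  have h0 : 0 < ρ := Real.exp_pos _
  have h1 : ρ < 1 := by
    rw [hρ, Real.exp_lt_one_iff]
    have := mul_pos Real.two_pi_pos hy
    linarith
  have htend : Tendsto (fun n : ℕ => K * ρ ^ (n + 1)) atTop (𝓝 0) := by
    simpa using ((tendsto_pow_atTop_nhds_zero_of_lt_one h0.le h1).comp
      (tendsto_add_atTop_nat 1)).const_mul K
  -- Past `M` the argument is smaller than `δ`, where the linear bound holds, and smaller than 1,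
  -- which excludes the pole of the kernel.
  obtain ⟨M, hM⟩ := eventually_atTop.1 (htend.eventually (gt_mem_nhds (lt_min hδ one_pos)))
  refine ⟨C * (K * ρ), ρ, h0, h1, M, fun n hn t z ht hz => ?_⟩
  have h2 := norm_nome_add_mul_le ht hz n
  have h3 := h2.trans_lt (hM n hn)
  rw [lt_min_iff] at h3
  refine ⟨fun h => ?_, (hb _ h3.1).trans ?_⟩
  · rw [h] at h3; simp at h3
  · calc C * ‖nome (z + (n + 1) * t)‖ ≤ C * (K * ρ ^ (n + 1)) := by gcongr
      _ = _ := by ring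

lemma IsNomeKernel.summable {P : ℂ → ℂ} (hP : IsNomeKernel P) (m : ℕ) {t : ℂ} (ht : 0 < t.im)
    (z : ℂ) : Summable fun n : ℕ => ((n : ℂ) + 1) ^ m * P (nome (z + (n + 1) * t)) := by
  obtain ⟨C, ρ, h0, h1, M, h⟩ := hP.exists_tail_bound ht (-z.im)
  have hs : Summable fun n : ℕ => C * ρ⁻¹ * (((n + 1 : ℕ) : ℝ) ^ m * ρ ^ (n + 1)) := by
    refine Summable.mul_left _ ?_
    refine (summable_nat_add_iff 1 (f := fun n : ℕ => (n : ℝ) ^ m * ρ ^ n)).2 ?_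
    exact summable_pow_mul_geometric_of_norm_lt_one m (by rwa [Real.norm_of_nonneg h0.le])
  refine Summable.of_norm_bounded_eventually_nat hs ?_
  filter_upwards [eventually_ge_atTop M] with n hn
  have h2 := (h n hn t z le_rfl (by simp)).2
  rw [norm_mul, norm_pow]
  have h3 : ‖(n : ℂ) + 1‖ = ((n + 1 : ℕ) : ℝ) := by
    rw [← Nat.cast_succ, Complex.norm_natCast]
  rw [h3]
  calc (((n + 1 : ℕ) : ℝ)) ^ m * ‖P (nome (z + (n + 1) * t))‖
      ≤ (((n + 1 : ℕ) : ℝ)) ^ m * (C * ρ ^ n) := by gcongr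
    _ = _ := by field_simp; ring

/-- The series is differentiable in both variables, and can be differentiated termwise. -/
lemma IsNomeKernel.hasFDerivAt_nomeSeries {P : ℂ → ℂ} (hP : IsNomeKernel P) (m : ℕ) {t z : ℂ}
    (ht : 0 < t.im) (h : ∀ n : ℕ, nome (z + (n + 1) * t) ≠ 1) :
    HasFDerivAt (fun p : ℂ × ℂ => nomeSeries m P p.1 p.2)
      (nomeSeries (m + 1) (QuasiJacobi.nomeDeriv P) t z • ContinuousLinearMap.fst ℂ ℂ ℂ +
        nomeSeries m (QuasiJacobi.nomeDeriv P) t z • ContinuousLinearMap.snd ℂ ℂ ℂ) (t, z) := by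
  set D := QuasiJacobi.nomeDeriv P with hD
  have hDk : IsNomeKernel D := hP.nomeDeriv
  obtain ⟨C, ρ, h0, h1, M, hM⟩ := hDk.exists_tail_bound (half_pos ht) (-(z.im - 1))
  let L : ℕ → ℂ × ℂ →L[ℂ] ℂ := fun n =>
    ((n : ℂ) + 1) • ContinuousLinearMap.fst ℂ ℂ ℂ + ContinuousLinearMap.snd ℂ ℂ ℂ
  let f : ℕ → ℂ × ℂ → ℂ := fun n p => ((n : ℂ) + 1) ^ m * P (nome (p.2 + (n + 1) * p.1))
  let f' : ℕ → ℂ × ℂ → ℂ × ℂ →L[ℂ] ℂ := fun n p =>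
    (((n : ℂ) + 1) ^ m * D (nome (p.2 + (n + 1) * p.1))) • L n
  have hterm (n : ℕ) (p : ℂ × ℂ) (hp : nome (p.2 + (n + 1) * p.1) ≠ 1) :
      HasFDerivAt (f n) (f' n p) p := by
    have hL : HasFDerivAt (fun p : ℂ × ℂ => p.2 + ((n : ℂ) + 1) * p.1) (L n) p := by
      refine (L n).hasFDerivAt.congr_of_eventuallyEq (Eventually.of_forall fun p => ?_)
      simp [L, add_comm]
    have := ((hP.hasDerivAt hp).comp_hasFDerivAt p hL).const_mul (((n : ℂ) + 1) ^ m)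
    rw [smul_smul] at this
    exact this
  -- On this ball the imaginary parts satisfy the bounds for which `M` was chosen.
  set ε := min (t.im / 2) 1 with hε
  have hε0 : 0 < ε := lt_min (half_pos ht) one_pos
  have hball (p : ℂ × ℂ) (hp : p ∈ Metric.ball (t, z) ε) :
      t.im / 2 ≤ p.1.im ∧ -(-(z.im - 1)) ≤ p.2.im := by
    rw [Metric.mem_ball, Prod.dist_eq, max_lt_iff] at hp
    have e1 : |(p.1 - t).im| < t.im / 2 := (Complex.abs_im_le_norm _).trans_lt
      ((dist_eq_norm p.1 t ▸ hp.1).trans_le (min_le_left _ _))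
    have e2 : |(p.2 - z).im| < 1 := (Complex.abs_im_le_norm _).trans_lt
      ((dist_eq_norm p.2 z ▸ hp.2).trans_le (min_le_right _ _))
    rw [Complex.sub_im, abs_lt] at e1 e2
    exact ⟨by linarith, by linarith⟩
  have hLn (n : ℕ) : ‖L n‖ ≤ (n : ℝ) + 2 := by
    have h3 : ‖(n : ℂ) + 1‖ = (n : ℝ) + 1 := by
      rw [← Nat.cast_succ, Complex.norm_natCast]; simp
    calc ‖L n‖ ≤ ‖((n : ℂ) + 1) • ContinuousLinearMap.fst ℂ ℂ ℂ‖ +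
          ‖ContinuousLinearMap.snd ℂ ℂ ℂ‖ := norm_add_le _ _
      _ ≤ ((n : ℝ) + 1) * 1 + 1 := by
        rw [norm_smul, h3]
        gcongr
        · exact ContinuousLinearMap.norm_fst_le ℂ ℂ ℂ
        · exact ContinuousLinearMap.norm_snd_le ℂ ℂ ℂ
      _ = _ := by ring
  -- The tail has no poles on the ball and is dominated by a geometric series with polynomial
  -- weights. The finite head only needs to avoid its poles at the point itself.
  have htail : HasFDerivAt (fun p => ∑' n, f (n + M) p) (∑' n, f' (n + M) (t, z)) (t, z) := by
    have hu : Summable fun n : ℕ =>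
        C * ρ⁻¹ ^ 2 * (((n + M + 2 : ℕ) : ℝ) ^ (m + 1) * ρ ^ (n + M + 2)) := by
      refine Summable.mul_left _ ?_
      refine (summable_nat_add_iff (M + 2) (f := fun n : ℕ => (n : ℝ) ^ (m + 1) * ρ ^ n)).2 ?_
      exact summable_pow_mul_geometric_of_norm_lt_one _ (by rwa [Real.norm_of_nonneg h0.le])
    refine hasFDerivAt_tsum_of_isPreconnected hu Metric.isOpen_ball
      (convex_ball (t, z) ε).isPreconnected (fun n p hp => ?_) (fun n p hp => ?_)
      (Metric.mem_ball_self hε0) ?_ (Metric.mem_ball_self hε0)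
    · exact hterm _ p ((hM (n + M) (by omega) p.1 p.2 (hball p hp).1 (hball p hp).2).1)
    · have h2 := (hM (n + M) (by omega) p.1 p.2 (hball p hp).1 (hball p hp).2).2
      have h3 : ‖((n + M : ℕ) : ℂ) + 1‖ = ((n + M : ℕ) : ℝ) + 1 := by
        rw [← Nat.cast_succ, Complex.norm_natCast]; simp
      have h4 : ((n + M + 2 : ℕ) : ℝ) = ((n + M : ℕ) : ℝ) + 2 := by push_cast; ring
      have hC : 0 ≤ C * ρ ^ (n + M) := (norm_nonneg _).trans h2
      rw [h4, norm_smul, norm_mul, norm_pow, h3]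
      calc (((n + M : ℕ) : ℝ) + 1) ^ m * ‖D (nome (p.2 + ((n + M : ℕ) + 1) * p.1))‖ * ‖L (n + M)‖
          ≤ (((n + M : ℕ) : ℝ) + 2) ^ m * (C * ρ ^ (n + M)) * (((n + M : ℕ) : ℝ) + 2) := by
            gcongr
            · linarith
            · exact hLn _
        _ = _ := by field_simp; ring
    · exact (summable_nat_add_iff M).2 (hP.summable m ht z)
  have hhead : HasFDerivAt (fun p => ∑ n ∈ Finset.range M, f n p)
      (∑ n ∈ Finset.range M, f' n (t, z)) (t, z) :=
    HasFDerivAt.fun_sum fun n _ => hterm n (t, z) (h n)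
  have hs1 := hDk.summable (m + 1) ht z
  have hs2 := hDk.summable m ht z
  have hf'eq (n : ℕ) : f' n (t, z) =
      (((n : ℂ) + 1) ^ (m + 1) * D (nome (z + (n + 1) * t))) • ContinuousLinearMap.fst ℂ ℂ ℂ +
      (((n : ℂ) + 1) ^ m * D (nome (z + (n + 1) * t))) • ContinuousLinearMap.snd ℂ ℂ ℂ := by
    simp only [f', L, smul_add, smul_smul]
    congr 2
    ring
  have hsum' : Summable fun n => f' n (t, z) := by
    simp only [hf'eq]
    exact (hs1.smul_const _).add (hs2.smul_const _)
  have hval : ∑ n ∈ Finset.range M, f' n (t, z) + ∑' n, f' (n + M) (t, z) =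
      nomeSeries (m + 1) D t z • ContinuousLinearMap.fst ℂ ℂ ℂ +
        nomeSeries m D t z • ContinuousLinearMap.snd ℂ ℂ ℂ := by
    rw [hsum'.sum_add_tsum_nat_add M]
    simp only [hf'eq]
    rw [(hs1.smul_const _).tsum_add (hs2.smul_const _), hs1.tsum_smul_const, hs2.tsum_smul_const]
    rfl
  rw [← hval]
  refine (hhead.add htail).congr_of_eventuallyEq ?_
  filter_upwards [Metric.ball_mem_nhds (t, z) hε0] with p hp
  have hp1 : 0 < p.1.im := (half_pos ht).trans_le (hball p hp).1
  exact ((hP.summable m hp1 p.2).sum_add_tsum_nat_add M).symm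

/-- A bound near `0` is not enough for the `q`-expansion, whose first term already has `|x|` up to
`r`; compactness gives one for `P x / x` on the whole closed disc. -/
lemma IsNomeKernel.exists_bound_of_lt_one {P : ℂ → ℂ} (hP : IsNomeKernel P) {r : ℝ} (h0 : 0 < r)
    (hr : r < 1) : ∃ C, ∀ x, ‖x‖ ≤ r → ‖P x‖ ≤ C * ‖x‖ := by
  have hsub : Metric.closedBall (0 : ℂ) r ⊆ {1}ᶜ := by
    rintro x hx rfl
    simp at hx
    linarith
  have hc : ContinuousOn (dslope P 0) (Metric.closedBall 0 r) :=
    (continuousOn_dslope (Metric.closedBall_mem_nhds 0 h0)).2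
      ⟨(hP.1.mono hsub).continuousOn, hP.differentiableAt zero_ne_one⟩
  obtain ⟨C, hC⟩ := (isCompact_closedBall (0 : ℂ) r).exists_bound_of_continuousOn hc
  refine ⟨C, fun x hx => ?_⟩
  have h1 := sub_smul_dslope P 0 x
  rw [hP.2, sub_zero, sub_zero, smul_eq_mul] at h1
  rw [← h1, norm_mul, mul_comm]
  gcongr
  exact hC x (by simpa using hx)

/-- At `z = 0` the series is `∑ P (q ^ (n + 1))`, which converges locally uniformly on `|q| < 1`,
including `q = 0`, because `P` vanishes at `0`. -/
lemma IsNomeKernel.holomorphicWithCusp {P : ℂ → ℂ} (hP : IsNomeKernel P) :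
    HolomorphicWithCusp fun τ => nomeSeries 0 P τ 0 := by
  refine holomorphicWithCusp_iff.2 ⟨fun q => ∑' n : ℕ, P (q ^ (n + 1)), ?_, fun τ => ?_⟩
  · intro q hq
    rw [mem_ball_zero_iff] at hq
    obtain ⟨r, hqr, hr⟩ := exists_between hq
    have h0 : 0 < r := (norm_nonneg q).trans_lt hqr
    obtain ⟨C, hC⟩ := hP.exists_bound_of_lt_one h0 hr
    have hpow (n : ℕ) (x : ℂ) (hx : x ∈ Metric.ball (0 : ℂ) r) : ‖x ^ (n + 1)‖ ≤ r ^ (n + 1) := by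
      rw [mem_ball_zero_iff] at hx
      rw [norm_pow]; gcongr
    have hpow' (n : ℕ) : r ^ (n + 1) ≤ r := pow_le_of_le_one h0.le hr.le n.succ_ne_zero
    have hCn : 0 ≤ C := by
      have := (norm_nonneg _).trans (hC (r : ℂ) (by simp [abs_of_pos h0]))
      rw [Complex.norm_real, Real.norm_of_nonneg h0.le] at this
      exact nonneg_of_mul_nonneg_left this h0
    have hs : Summable fun n : ℕ => C * r ^ (n + 1) :=
      ((summable_nat_add_iff 1).2 (summable_geometric_of_lt_one h0.le hr)).mul_left C
    have := Complex.differentiableOn_tsum_of_summable_norm (U := Metric.ball (0 : ℂ) r)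
      (F := fun (n : ℕ) (x : ℂ) => P (x ^ (n + 1))) hs (fun n => ?_) Metric.isOpen_ball (fun n x hx => ?_)
    · exact (this.differentiableAt (Metric.isOpen_ball.mem_nhds (by simpa using hqr))).differentiableWithinAt
    · refine hP.1.comp (by fun_prop) fun x hx h1 => ?_
      have := (hpow n x hx).trans (hpow' n)
      rw [h1, norm_one] at this
      linarith
    · calc _ ≤ C * ‖x ^ (n + 1)‖ := hC _ ((hpow n x hx).trans (hpow' n))
        _ ≤ _ := by gcongr; exact hpow n x hx
  · refine tsum_congr fun n => ?_
    rw [← nome_nat_mul]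
    simp

lemma nome_ne_one_of_off_lattice {τ : ℍ} {z : ℂ} (hz : z ∉ lattice τ) (n : ℤ) :
    nome (z + n * τ) ≠ 1 := by
  rw [Ne, nome_eq_one_iff]
  rintro ⟨m, h⟩
  exact hz ⟨m, -n, by push_cast; linear_combination h⟩

lemma nome_ne_one_of_off_lattice' {τ : ℍ} {z : ℂ} (hz : z ∉ lattice τ) (n : ℕ) :
    nome (z + (n + 1) * τ) ≠ 1 := by
  simpa using nome_ne_one_of_off_lattice hz (n + 1)

lemma nome_ne_one_of_im {τ : ℍ} {z : ℂ} (hz : -τ.im < z.im) (n : ℕ) :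
    nome (z + (n + 1) * τ) ≠ 1 := by
  rw [Ne, nome_eq_one_iff]
  rintro ⟨m, h⟩
  have := congrArg Complex.im h
  simp at this
  have h1 : (n : ℝ) * τ.im ≥ 0 := by have := τ.im_pos; positivity
  nlinarith

lemma IsNomeKernel.hasDerivAt_nomeSeries {P : ℂ → ℂ} (hP : IsNomeKernel P) (m : ℕ) {t z : ℂ}
    (ht : 0 < t.im) (h : ∀ n : ℕ, nome (z + (n + 1) * t) ≠ 1) :
    HasDerivAt (nomeSeries m P t) (nomeSeries m (QuasiJacobi.nomeDeriv P) t z) z := by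
  have h1 : HasDerivAt (fun x : ℂ => (t, x)) ((0 : ℂ), (1 : ℂ)) z :=
    (hasDerivAt_const z t).prodMk (hasDerivAt_id z)
  have := (hP.hasFDerivAt_nomeSeries m ht h).comp_hasDerivAt z h1
  simpa [Function.comp_def] using this

/-- The summation starts at `n = 1`, so there is no pole for `Im z > -Im τ`. There each
`z`-derivative is the series of a new kernel, and its value at `0` has a cusp expansion. -/
lemma IsNomeKernel.hasCuspTaylor {P : ℂ → ℂ} (hP : IsNomeKernel P) :
    HasCuspTaylor fun τ z => nomeSeries 0 P τ z := by
  have hU (τ : ℍ) : IsOpen {z : ℂ | -τ.im < z.im} := isOpen_lt continuous_const Complex.continuous_im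
  have h0 (τ : ℍ) : (0 : ℂ) ∈ {z : ℂ | -τ.im < z.im} := by simpa using τ.im_pos
  refine ⟨fun τ => ?_, fun n => ?_⟩
  · have : DifferentiableOn ℂ (nomeSeries 0 P τ) {z : ℂ | -τ.im < z.im} := fun z hz =>
      (hP.hasDerivAt_nomeSeries 0 τ.im_pos (nome_ne_one_of_im hz)).differentiableAt.differentiableWithinAt
    exact this.analyticAt ((hU τ).mem_nhds (h0 τ))
  · suffices h : ∀ (n : ℕ) (P : ℂ → ℂ), IsNomeKernel P → ∀ τ : ℍ, ∀ z : ℂ, -τ.im < z.im →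
        iteratedDeriv n (nomeSeries 0 P τ) z = nomeSeries 0 (QuasiJacobi.nomeDeriv^[n] P) τ z ∧
        IsNomeKernel (QuasiJacobi.nomeDeriv^[n] P) by
      simp only [fun τ => (h n P hP τ 0 (h0 τ)).1]
      exact (h n P hP I 0 (h0 I)).2.holomorphicWithCusp
    intro n
    induction n with
    | zero => exact fun P hP τ z _ => ⟨by simp, hP⟩
    | succ n ih =>
      intro P hP τ z hz
      obtain ⟨h1, h2⟩ := ih _ hP.nomeDeriv τ z hz
      refine ⟨?_, h2⟩
      rw [iteratedDeriv_succ', Function.iterate_succ_apply, ← h1]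
      refine Filter.EventuallyEq.iteratedDeriv_eq n ?_
      filter_upwards [(hU τ).mem_nhds hz] with x hx
      exact (hP.hasDerivAt_nomeSeries 0 τ.im_pos (nome_ne_one_of_im hx)).deriv

lemma HasCuspTaylor.comp_neg {f : Fun2} (hf : HasCuspTaylor f) :
    HasCuspTaylor fun τ z => f τ (-z) := by
  refine ⟨fun τ => ?_, fun n => ?_⟩
  · have h1 : AnalyticAt ℂ (f τ) (-0) := by simpa using hf.1 τ
    exact h1.comp (f := fun z : ℂ => -z) (by fun_prop)
  · simp only [iteratedDeriv_comp_neg, neg_zero, smul_eq_mul]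
    exact (HolomorphicWithCusp.const _).mul (hf.2 n)

/-! ### The function `E₁` -/

/-- The kernel `-2πi x / (1 - x)`, so that `π cot (πz) = -πi + cotKernel (exp (2πiz))`. -/
def cotKernel (x : ℂ) : ℂ := -(2 * Real.pi * Complex.I) * (x / (1 - x))

lemma isNomeKernel_cotKernel : IsNomeKernel cotKernel := by
  refine ⟨fun x hx => ?_, by simp [cotKernel]⟩
  have : 1 - x ≠ 0 := sub_ne_zero.2 (Ne.symm hx)
  unfold cotKernel
  exact (DifferentiableAt.const_mul (by fun_prop (disch := assumption)) _).differentiableWithinAt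

lemma isNomeKernel_iterate (k : ℕ) : IsNomeKernel (nomeDeriv^[k] cotKernel) := by
  induction k with
  | zero => exact isNomeKernel_cotKernel
  | succ k ih => rw [Function.iterate_succ_apply']; exact ih.nomeDeriv

/-- This reflection formula is the source of the oddness of `E₁` and of its quasi-period `-2πi`. -/
lemma cotKernel_add_inv {x : ℂ} (h0 : x ≠ 0) (h1 : x ≠ 1) :
    cotKernel x + cotKernel x⁻¹ = 2 * Real.pi * Complex.I := by
  have h2 : 1 - x ≠ 0 := sub_ne_zero.2 (Ne.symm h1)
  have h3 : x - 1 ≠ 0 := sub_ne_zero.2 h1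
  have h4 : x⁻¹ / (1 - x⁻¹) = 1 / (x - 1) := by
    field_simp
  rw [cotKernel, cotKernel, h4]
  have : x / (1 - x) + 1 / (x - 1) = -1 := by
    rw [← neg_sub x 1, div_neg, neg_add_eq_sub, ← sub_div, div_eq_iff h3]; ring
  linear_combination (-(2 * Real.pi * Complex.I)) * this

lemma nome_neg (z : ℂ) : nome (-z) = (nome z)⁻¹ := by
  simp [nome, Complex.exp_neg]

lemma pi_mul_cot {z : ℂ} (hz : nome z ≠ 1) :
    Real.pi * Complex.cot (Real.pi * z) = -(Real.pi * Complex.I) + cotKernel (nome z) := by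
  have h2 : 1 - nome z ≠ 0 := sub_ne_zero.2 (Ne.symm hz)
  rw [Complex.cot_pi_eq_exp_ratio, cotKernel]
  rw [show Complex.exp (2 * Real.pi * Complex.I * z) = nome z from rfl]
  have hI : Complex.I ≠ 0 := Complex.I_ne_zero
  field_simp
  linear_combination (1 + nome z) * Complex.I_sq

/-- The `k`-th derivative in `z` of `E₁`, off the lattice. -/
def E₁deriv (k : ℕ) : Fun2 := fun τ z =>
  (if k = 0 then -(Real.pi * Complex.I) else 0) + (nomeDeriv^[k] cotKernel) (nome z) +
    nomeSeries 0 (nomeDeriv^[k] cotKernel) τ z -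
      (-1) ^ k * nomeSeries 0 (nomeDeriv^[k] cotKernel) τ (-z)

/-- The derivative in `τ` of `E₁deriv k`. -/
def E₁derivTau (k : ℕ) : Fun2 := fun τ z =>
  nomeSeries 1 (nomeDeriv^[k + 1] cotKernel) τ z -
      (-1) ^ k * nomeSeries 1 (nomeDeriv^[k + 1] cotKernel) τ (-z)

lemma sum_Icc_neg_eq {M : Type*} [AddCommMonoid M] (f : ℤ → M) (N : ℕ) :
    ∑ n ∈ Finset.Icc (-(N : ℤ)) N, f n =
      f 0 + ∑ n ∈ Finset.range N, (f (n + 1) + f (-(n + 1))) := by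
  induction N with
  | zero => simp
  | succ N ih =>
    have : Finset.Icc (-((N + 1 : ℕ) : ℤ)) ((N + 1 : ℕ) : ℤ) =
        insert ((N : ℤ) + 1) (insert (-((N : ℤ) + 1)) (Finset.Icc (-(N : ℤ)) N)) := by
      ext x
      simp only [Finset.mem_insert, Finset.mem_Icc]
      push_cast
      omega
    rw [this, Finset.sum_insert, Finset.sum_insert, ih, Finset.sum_range_succ]
    · abel
    · simp
    · simp only [Finset.mem_insert, Finset.mem_Icc]; omega

/-- This is the partial fraction expansion of the cotangent, summed symmetrically. -/
lemma tsum_symmetricIcc_one_div {w : ℂ} (hw : nome w ≠ 1) :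
    ∑'[SummationFilter.symmetricIcc ℤ] m : ℤ, 1 / (w + (m : ℂ)) =
      -(Real.pi * Complex.I) + cotKernel (nome w) := by
  have hw' : w ∈ Complex.integerComplement := by
    rw [Complex.mem_integerComplement_iff]
    rintro ⟨n, h⟩
    exact hw (h ▸ nome_intCast n)
  rw [← pi_mul_cot hw]
  refine HasSum.tsum_eq ?_
  rw [SummationFilter.hasSum_symmetricIcc_iff]
  have := (tendsto_logDeriv_euler_cot_sub hw').const_add (1 / w)
  rw [add_sub_cancel] at this
  refine this.congr fun N => ?_
  rw [sum_Icc_neg_eq]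
  congr 1
  · simp
  · refine Finset.sum_congr rfl fun n _ => ?_
    simp only [cotTerm]
    push_cast
    rw [add_comm, ← sub_eq_add_neg]

/-- Each inner sum is `-πi + cotKernel`. Pairing the rows `n` and `-n` and inverting the argument in
the second, the reflection formula cancels the two constants `-πi`, leaving absolutely convergent
series. -/
lemma E₁_eq {τ : ℍ} {z : ℂ} (hz : z ∉ lattice τ) : E₁ τ z = E₁deriv 0 τ z := by
  have hinner (n : ℤ) : ∑'[SummationFilter.symmetricIcc ℤ] m : ℤ, 1 / (z + (m : ℂ) + n * (τ : ℂ)) =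
      -(Real.pi * Complex.I) + cotKernel (nome (z + n * τ)) := by
    rw [← tsum_symmetricIcc_one_div (nome_ne_one_of_off_lattice hz n)]
    simp only [add_right_comm]
  have hz' : -z ∉ lattice τ := by simpa
  simp only [E₁, hinner, E₁deriv, if_true, Function.iterate_zero, id, pow_zero, one_mul]
  refine HasSum.tsum_eq ?_
  rw [SummationFilter.hasSum_symmetricIcc_iff]
  have h1 := ((isNomeKernel_cotKernel.summable 0 τ.im_pos z).hasSum.tendsto_sum_nat.sub
    (isNomeKernel_cotKernel.summable 0 τ.im_pos (-z)).hasSum.tendsto_sum_nat).const_add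
      (-(Real.pi * Complex.I) + cotKernel (nome z))
  rw [← add_sub_assoc] at h1
  refine h1.congr fun N => ?_
  rw [sum_Icc_neg_eq, ← Finset.sum_sub_distrib]
  congr 1
  · simp
  · refine Finset.sum_congr rfl fun n _ => ?_
    have h2 : nome (z + ((-((n : ℤ) + 1) : ℤ) : ℂ) * τ) = (nome (-z + (n + 1) * τ))⁻¹ := by
      rw [← nome_neg]; congr 1; push_cast; ring
    have h3 := cotKernel_add_inv (nome_ne_zero _) (nome_ne_one_of_off_lattice' hz' n)
    rw [h2]
    push_cast
    simp only [pow_zero, one_mul]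
    linear_combination -h3

/-! ### Partial derivatives -/

/-- `f` is, off the lattice, differentiable in `(τ, z)` with partial derivatives `ft` and `fz`. -/
def HasPartials (f ft fz : Fun2) : Prop :=
  ∀ τ : ℍ, ∀ z ∉ lattice τ, HasFDerivAt (fun p : ℂ × ℂ => f (ofComplex p.1) p.2)
    (ft τ z • ContinuousLinearMap.fst ℂ ℂ ℂ + fz τ z • ContinuousLinearMap.snd ℂ ℂ ℂ) ((τ : ℂ), z)

namespace HasPartials

variable {f ft fz g gt gz : Fun2}

lemma congr (h : HasPartials f ft fz) (e : ∀ τ, ∀ z ∉ lattice τ, g τ z = f τ z) :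
    HasPartials g ft fz := fun τ z hz =>
  (h τ z hz).congr_of_eventuallyEq ((eventually_off_lattice hz).mono fun _ hp => e _ _ hp.2)

lemma congr_partials (h : HasPartials f ft fz) (e : ∀ τ, ∀ z ∉ lattice τ, gt τ z = ft τ z)
    (e' : ∀ τ, ∀ z ∉ lattice τ, gz τ z = fz τ z) : HasPartials f gt gz := fun τ z hz => by
  rw [e τ z hz, e' τ z hz]; exact h τ z hz

lemma add (hf : HasPartials f ft fz) (hg : HasPartials g gt gz) :
    HasPartials (fun τ z => f τ z + g τ z) (fun τ z => ft τ z + gt τ z)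
      (fun τ z => fz τ z + gz τ z) := fun τ z hz => by
  refine ((hf τ z hz).add (hg τ z hz)).congr_fderiv ?_
  module

lemma mul (hf : HasPartials f ft fz) (hg : HasPartials g gt gz) :
    HasPartials (fun τ z => f τ z * g τ z) (fun τ z => ft τ z * g τ z + f τ z * gt τ z)
      (fun τ z => fz τ z * g τ z + f τ z * gz τ z) := fun τ z hz => by
  refine ((hf τ z hz).mul (hg τ z hz)).congr_fderiv ?_
  simp only [ofComplex_apply]
  module

lemma coeff {A B : ℍ → ℂ}
    (h : ∀ τ : ℍ, HasDerivAt (fun t => A (ofComplex t)) (B τ) (τ : ℂ)) :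
    HasPartials (fun τ _ => A τ) (fun τ _ => B τ) (fun _ _ => 0) := fun τ z _ => by
  refine (HasDerivAt.comp_hasFDerivAt (f := Prod.fst) ((τ : ℂ), z) (h τ)
    hasFDerivAt_fst).congr_fderiv ?_
  beta_reduce
  module

/-- Differentiation along a holomorphic curve. -/
lemma comp (h : HasPartials f ft fz) {τ : ℍ} {z : ℂ} (hz : z ∉ lattice τ) {u v : ℂ → ℂ}
    {s u' v' : ℂ} (hu : HasDerivAt u u' s) (hv : HasDerivAt v v' s) (hus : u s = τ)
    (hvs : v s = z) :
    HasDerivAt (fun s => f (ofComplex (u s)) (v s)) (ft τ z * u' + fz τ z * v') s := by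
  have h1 := h τ z hz
  rw [← hus, ← hvs] at h1
  refine (HasFDerivAt.comp_hasDerivAt (f := fun s => (u s, v s)) s h1
    (hu.prodMk hv)).congr_deriv ?_
  simp [hvs]

lemma hasDerivAt_z (h : HasPartials f ft fz) {τ : ℍ} {z : ℂ} (hz : z ∉ lattice τ) :
    HasDerivAt (f τ) (fz τ z) z := by
  have := h.comp hz (hasDerivAt_const z (τ : ℂ)) (hasDerivAt_id z) rfl rfl
  simpa using this

lemma hasDerivAt_tau (h : HasPartials f ft fz) {τ : ℍ} {z : ℂ} (hz : z ∉ lattice τ) :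
    HasDerivAt (tauSlice f z) (ft τ z) τ := by
  have := h.comp hz (hasDerivAt_id (τ : ℂ)) (hasDerivAt_const (τ : ℂ) z) rfl rfl
  exact this.congr_deriv (by simp)

end HasPartials

lemma hasFDerivAt_nomeSeries_comp_neg {P : ℂ → ℂ} (hP : IsNomeKernel P) (m : ℕ) {t z : ℂ}
    (ht : 0 < t.im) (h : ∀ n : ℕ, nome (-z + (n + 1) * t) ≠ 1) :
    HasFDerivAt (fun p : ℂ × ℂ => nomeSeries m P p.1 (-p.2))
      (nomeSeries (m + 1) (nomeDeriv P) t (-z) • ContinuousLinearMap.fst ℂ ℂ ℂ -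
        nomeSeries m (nomeDeriv P) t (-z) • ContinuousLinearMap.snd ℂ ℂ ℂ) (t, z) := by
  have h1 : HasFDerivAt (fun p : ℂ × ℂ => (p.1, -p.2))
      ((ContinuousLinearMap.fst ℂ ℂ ℂ).prod (-ContinuousLinearMap.snd ℂ ℂ ℂ)) (t, z) :=
    hasFDerivAt_fst.prodMk hasFDerivAt_snd.neg
  refine (HasFDerivAt.comp (f := fun p : ℂ × ℂ => (p.1, -p.2)) (t, z)
    (hP.hasFDerivAt_nomeSeries m ht h) h1).congr_fderiv ?_
  ext <;> simp

lemma off_lattice_neg {τ : ℍ} {z : ℂ} (hz : z ∉ lattice τ) : -z ∉ lattice τ := by simpa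

lemma nome_ne_one {τ : ℍ} {z : ℂ} (hz : z ∉ lattice τ) : nome z ≠ 1 := by
  simpa using nome_ne_one_of_off_lattice hz 0

lemma hasPartials_E₁deriv (k : ℕ) : HasPartials (E₁deriv k) (E₁derivTau k) (E₁deriv (k + 1)) := by
  intro τ z hz
  have hK := isNomeKernel_iterate k
  have h1 := hK.hasFDerivAt_nomeSeries 0 τ.im_pos (nome_ne_one_of_off_lattice' hz)
  have h2 := (hasFDerivAt_nomeSeries_comp_neg hK 0 τ.im_pos
    (nome_ne_one_of_off_lattice' (off_lattice_neg hz))).const_mul ((-1) ^ k)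
  have h3 : HasFDerivAt (fun p : ℂ × ℂ => (nomeDeriv^[k] cotKernel) (nome p.2))
      (nomeDeriv (nomeDeriv^[k] cotKernel) (nome z) • ContinuousLinearMap.snd ℂ ℂ ℂ) ((τ : ℂ), z) :=
    HasDerivAt.comp_hasFDerivAt (f := Prod.snd) ((τ : ℂ), z) (hK.hasDerivAt (nome_ne_one hz))
      hasFDerivAt_snd
  have h4 := ((h3.const_add (if k = 0 then -(Real.pi * Complex.I) else 0)).add h1).sub h2
  rw [← Function.iterate_succ_apply' nomeDeriv] at h4
  refine (h4.congr_of_eventuallyEq ?_).congr_fderiv ?_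
  · filter_upwards [eventually_off_lattice hz] with p hp
    simp [E₁deriv, ofComplex_apply_of_im_pos hp.1]
  · simp only [E₁deriv, E₁derivTau, Nat.add_eq_zero_iff, one_ne_zero, and_false, if_false, zero_add,
      pow_succ]
    module

lemma hasDerivAt_E₁derivTau (k : ℕ) {τ : ℍ} {z : ℂ}
    (h : ∀ n : ℕ, nome (z + (n + 1) * τ) ≠ 1) (h' : ∀ n : ℕ, nome (-z + (n + 1) * τ) ≠ 1) :
    HasDerivAt (E₁derivTau k τ) (E₁derivTau (k + 1) τ z) z := by
  have hK := isNomeKernel_iterate (k + 1)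
  have h1 := hK.hasDerivAt_nomeSeries 1 τ.im_pos h
  have h2 := ((hK.hasDerivAt_nomeSeries 1 τ.im_pos h').comp z (hasDerivAt_neg z)).const_mul
    ((-1) ^ k)
  have h3 := h1.sub h2
  rw [← Function.iterate_succ_apply' nomeDeriv] at h3
  refine h3.congr_deriv ?_
  simp only [E₁derivTau, pow_succ]
  ring

/-- The pole of `E₁` at `0` sits in the cotangent term, which does not depend on `τ` and so has
disappeared here. -/
lemma analyticAt_E₁derivTau (k : ℕ) (τ : ℍ) : AnalyticAt ℂ (E₁derivTau k τ) 0 := by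
  have hU : IsOpen {z : ℂ | -τ.im < z.im ∧ z.im < τ.im} :=
    (isOpen_lt continuous_const Complex.continuous_im).inter
      (isOpen_lt Complex.continuous_im continuous_const)
  have h0 : (0 : ℂ) ∈ {z : ℂ | -τ.im < z.im ∧ z.im < τ.im} := by simpa using τ.im_pos
  have : DifferentiableOn ℂ (E₁derivTau k τ) {z : ℂ | -τ.im < z.im ∧ z.im < τ.im} := fun z hz =>
    (hasDerivAt_E₁derivTau k (nome_ne_one_of_im hz.1)
      (nome_ne_one_of_im (by simpa using hz.2))).differentiableAt.differentiableWithinAt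
  exact this.analyticAt (hU.mem_nhds h0)

/-! ### Periods, parity and poles of `E₁` -/

lemma E₁deriv_zero (τ : ℍ) (z : ℂ) : E₁deriv 0 τ z = -(Real.pi * Complex.I) + cotKernel (nome z) +
    nomeSeries 0 cotKernel τ z - nomeSeries 0 cotKernel τ (-z) := by
  simp [E₁deriv]

lemma nomeSeries_add_intCast (m : ℕ) (P : ℂ → ℂ) (t z : ℂ) (n : ℤ) :
    nomeSeries m P t (z + n) = nomeSeries m P t z := by
  refine tsum_congr fun j => ?_
  rw [add_right_comm, nome_add, nome_intCast, mul_one]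

lemma E₁deriv_zero_add_intCast (τ : ℍ) (z : ℂ) (n : ℤ) :
    E₁deriv 0 τ (z + n) = E₁deriv 0 τ z := by
  have h2 := nomeSeries_add_intCast 0 cotKernel τ (-z) (-n)
  push_cast at h2
  rw [E₁deriv_zero, E₁deriv_zero, nomeSeries_add_intCast, neg_add, h2, nome_add, nome_intCast,
    mul_one]

lemma E₁deriv_zero_neg {τ : ℍ} {z : ℂ} (hz : z ∉ lattice τ) :
    E₁deriv 0 τ (-z) = -E₁deriv 0 τ z := by
  have := cotKernel_add_inv (nome_ne_zero z) (nome_ne_one hz)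
  rw [E₁deriv_zero, E₁deriv_zero, nome_neg, neg_neg]
  linear_combination this

lemma nomeSeries_zero_eq {P : ℂ → ℂ} (hP : IsNomeKernel P) (τ : ℍ) (z : ℂ) :
    nomeSeries 0 P τ z = P (nome (z + τ)) + nomeSeries 0 P τ (z + τ) := by
  rw [nomeSeries, (hP.summable 0 τ.im_pos z).tsum_eq_zero_add]
  congr 1
  · simp
  · refine tsum_congr fun n => ?_
    push_cast
    simp only [pow_zero, one_mul]
    congr 2
    ring

/-- Translation by `τ` shifts both series by one index; the boundary terms add up to `-(cotKernel x
+ cotKernel x⁻¹)` with `x = nome z`. -/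
lemma E₁deriv_zero_add_tau {τ : ℍ} {z : ℂ} (hz : z ∉ lattice τ) :
    E₁deriv 0 τ (z + τ) = E₁deriv 0 τ z - 2 * Real.pi * Complex.I := by
  have h1 := cotKernel_add_inv (nome_ne_zero z) (nome_ne_one hz)
  have h2 := nomeSeries_zero_eq isNomeKernel_cotKernel τ z
  have h3 := nomeSeries_zero_eq isNomeKernel_cotKernel τ (-(z + τ))
  rw [neg_add, neg_add_cancel_right, nome_neg] at h3
  rw [E₁deriv_zero, E₁deriv_zero, neg_add, h3]
  linear_combination -h1 - h2

lemma add_int_mul_period {τ : ℍ} {f : ℂ → ℂ} {C : ℂ}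
    (h1 : ∀ z ∉ lattice τ, f (z + 1) = f z) (h2 : ∀ z ∉ lattice τ, f (z + τ) = f z + C)
    {z : ℂ} (hz : z ∉ lattice τ) (lam mu : ℤ) : f (z + lam * τ + mu) = f z + C * lam := by
  have hoff (m n : ℤ) : z + m * τ + n ∉ lattice τ := by simpa
  have hmu (n : ℤ) : f (z + lam * τ + n) = f (z + lam * τ) := by
    induction n with
    | zero => simp
    | succ n ih =>
      have := h1 _ (hoff lam n)
      push_cast at this ih ⊢
      rw [← add_assoc, this, ih]
    | pred n ih =>
      have := h1 _ (hoff lam (-n - 1))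
      push_cast at this ih ⊢
      rw [← ih, ← this]
      congr 1
      ring
  rw [hmu]
  have hoff' (n : ℤ) : z + n * τ ∉ lattice τ := by simpa using hoff n 0
  clear hmu
  induction lam with
  | zero => simp
  | succ n ih =>
    have := h2 _ (hoff' n)
    push_cast at this ih ⊢
    rw [add_mul, one_mul, ← add_assoc, this, ih]; ring
  | pred n ih =>
    have := h2 _ (hoff' (-n - 1))
    push_cast at this ih ⊢
    rw [sub_mul, one_mul, add_assoc, sub_add_cancel, ih] at this
    rw [sub_mul, one_mul]
    linear_combination -this

lemma E₁deriv_zero_add_period {τ : ℍ} {z : ℂ} (hz : z ∉ lattice τ) (lam mu : ℤ) :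
    E₁deriv 0 τ (z + lam * τ + mu) = E₁deriv 0 τ z - 2 * Real.pi * Complex.I * lam := by
  rw [add_int_mul_period (fun z _ => by simpa using E₁deriv_zero_add_intCast τ z 1)
    (fun z hz => (E₁deriv_zero_add_tau hz).trans (sub_eq_add_neg _ _)) hz]
  ring

/-- `z (-πi + cotKernel (exp (2πiz)))` extends holomorphically to `z = 0`, with value `1`. -/
lemma exists_cot_regular : ∃ c : ℂ → ℂ, AnalyticAt ℂ c 0 ∧ c 0 = 1 ∧
    ∀ z : ℂ, z ≠ 0 → nome z ≠ 1 → z * (-(Real.pi * Complex.I) + cotKernel (nome z)) = c z := by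
  have hs : Differentiable ℂ fun z : ℂ => Complex.sin (Real.pi * z) := by fun_prop
  have hd : HasDerivAt (fun z : ℂ => Complex.sin (Real.pi * z)) (Real.pi : ℂ) 0 := by
    have := ((hasDerivAt_id (0 : ℂ)).const_mul (Real.pi : ℂ)).csin
    simpa using this
  have han : AnalyticAt ℂ (dslope (fun z : ℂ => Complex.sin (Real.pi * z)) 0) 0 := by
    obtain ⟨p, hp⟩ := hs.analyticAt 0
    exact ⟨_, hp.has_fpower_series_dslope_fslope⟩
  have hval : dslope (fun z : ℂ => Complex.sin (Real.pi * z)) 0 0 = Real.pi := by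
    rw [dslope_same, hd.deriv]
  have hpi : (Real.pi : ℂ) ≠ 0 := by exact_mod_cast Real.pi_ne_zero
  refine ⟨fun z => Real.pi * Complex.cos (Real.pi * z) /
    dslope (fun z : ℂ => Complex.sin (Real.pi * z)) 0 z, ?_, ?_, fun z h0 h1 => ?_⟩
  · refine AnalyticAt.div ?_ han (by rwa [hval])
    exact Differentiable.analyticAt (by fun_prop) 0
  · beta_reduce
    rw [hval]; simp [hpi]
  · have h2 : z * dslope (fun z : ℂ => Complex.sin (Real.pi * z)) 0 z =
        Complex.sin (Real.pi * z) := by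
      simpa using sub_smul_dslope (fun z : ℂ => Complex.sin (Real.pi * z)) 0 z
    rw [← pi_mul_cot h1, Complex.cot, ← h2]
    simp only [div_eq_mul_inv, mul_inv]
    rw [mul_left_comm (Complex.cos _), mul_left_comm (Real.pi : ℂ), mul_inv_cancel_left₀ h0,
      mul_assoc]

/-- The leading coefficient is that of the `k`-th derivative of `1 / z`. Being a nonzero constant,
it can be divided by when poles are subtracted. -/
lemma E₁deriv_laurent (k : ℕ) : ∃ g, HasCuspTaylor g ∧ (∀ τ, g τ 0 = (-1) ^ k * k.factorial) ∧
    ∀ τ, ∀ᶠ z in 𝓝[≠] (0 : ℂ), z ^ (k + 1) * E₁deriv k τ z = g τ z := by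
  induction k with
  | zero =>
    obtain ⟨c, hc, hc0, hcz⟩ := exists_cot_regular
    have hS := isNomeKernel_cotKernel.hasCuspTaylor
    refine ⟨_, (HasCuspTaylor.of_analyticAt hc).add ((hS.sub hS.comp_neg).pow_mul 1),
      fun τ => by simp [hc0], fun τ => ?_⟩
    filter_upwards [eventually_punctured_off_lattice τ 0, self_mem_nhdsWithin] with z hz hne
    rw [E₁deriv_zero, ← hcz z hne (nome_ne_one hz)]
    ring
  | succ k ih =>
    obtain ⟨g, hg, hg0, e⟩ := ih
    refine ⟨_, (hg.deriv.pow_mul 1).sub (hg.const_mul ((k + 1 : ℕ) : ℂ)), fun τ => ?_, fun τ => ?_⟩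
    · simp only [pow_one, zero_mul, zero_sub, hg0, Nat.factorial_succ]
      push_cast
      ring
    · have hd : ∀ᶠ z in 𝓝[≠] (0 : ℂ), HasDerivAt (E₁deriv k τ) (E₁deriv (k + 1) τ z) z :=
        (eventually_punctured_off_lattice τ 0).mono fun z hz =>
          (hasPartials_E₁deriv k).hasDerivAt_z hz
      filter_upwards [eventually_pow_mul_deriv (e τ) (hd.mono fun z hz => hz.differentiableAt), hd]
        with z hz hdz
      rw [← hz, hdz.deriv]

lemma HasPoleOrderLE.comp_sub {N : ℕ} {f : ℂ → ℂ} (hf : HasPoleOrderLE N f 0) (w : ℂ) :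
    HasPoleOrderLE N (fun z => f (z - w)) w := by
  obtain ⟨u, hu, e⟩ := hf
  have ht : Tendsto (fun z : ℂ => z - w) (𝓝[≠] w) (𝓝[≠] 0) := by
    refine tendsto_nhdsWithin_of_tendsto_nhds_of_eventually_within _ ?_ ?_
    · have : Continuous fun z : ℂ => z - w := by fun_prop
      simpa using (this.tendsto w).mono_left nhdsWithin_le_nhds
    · filter_upwards [self_mem_nhdsWithin] with z hz
      exact sub_ne_zero.2 hz
  refine ⟨fun z => u (z - w), ?_, ?_⟩
  · have h1 : AnalyticAt ℂ u (w - w) := by simpa using hu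
    exact h1.comp (f := fun z : ℂ => z - w) (by fun_prop)
  · filter_upwards [ht.eventually e] with z hz
    simpa using hz

lemma HasCuspLaurent.hasPoleOrderLE {N : ℕ} {f : Fun2} (h : HasCuspLaurent N f) (τ : ℍ) :
    HasPoleOrderLE N (f τ) 0 := by
  obtain ⟨g, hg, e⟩ := h
  exact ⟨g τ, hg.1 τ, by simpa using e τ⟩

/-- Quasi-periodicity carries the bound for the pole at `0` to the other lattice points. -/
lemma hasPoleOrderLE_of_quasiperiodic {N : ℕ} {f : ℂ → ℂ} {τ : ℍ} {C : ℂ}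
    (h0 : HasPoleOrderLE N f 0)
    (hper : ∀ z ∉ lattice τ, ∀ lam mu : ℤ, f (z + lam * τ + mu) = f z + C * lam) :
    ∀ w ∈ lattice τ, HasPoleOrderLE N f w := by
  rintro w ⟨m, n, rfl⟩
  have h1 := (h0.comp_sub (m + n * τ)).add
    ((HasPoleOrderLE.of_analyticAt (analyticAt_const (v := C * n))).mono (Nat.zero_le N))
  refine h1.congr ?_
  filter_upwards [eventually_punctured_off_lattice τ (m + n * τ)] with z hz
  have hz' : z - (m + n * τ) ∉ lattice τ := by
    intro h
    refine hz ?_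
    have := (add_period_mem_lattice n m).2 h
    rwa [show z - (m + n * (τ : ℂ)) + n * τ + m = z by ring] at this
  rw [← hper _ hz' n m]
  congr 1
  ring

lemma isSingular_E₁deriv (k : ℕ) : IsSingular (E₁deriv k) := by
  induction k with
  | zero =>
    have hL : HasCuspLaurent 1 (E₁deriv 0) := by
      obtain ⟨g, hg, -, e⟩ := E₁deriv_laurent 0
      exact ⟨g, hg, e⟩
    refine isSingular_iff.2 ⟨fun τ z _ => by simpa using E₁deriv_zero_add_intCast τ z 1,
      fun τ z _ => ?_, fun τ z hz => ((hasPartials_E₁deriv 0).hasDerivAt_z hz).differentiableAt, 1,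
      fun τ => ?_, hL⟩
    · have h1 (P : ℂ → ℂ) (x : ℂ) :
          nomeSeries 0 P (((1 : ℝ) +ᵥ τ : ℍ) : ℂ) x = nomeSeries 0 P τ x := by
        refine tsum_congr fun n => ?_
        have : x + ((n : ℂ) + 1) * (((1 : ℝ) +ᵥ τ : ℍ) : ℂ) = x + (n + 1) * τ + ((n + 1 : ℤ) : ℂ) := by
          rw [coe_vadd]; push_cast; ring
        rw [this, nome_add, nome_intCast, mul_one]
      rw [E₁deriv_zero, E₁deriv_zero, h1, h1]
    · refine hasPoleOrderLE_of_quasiperiodic (C := -(2 * Real.pi * Complex.I))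
        (hL.hasPoleOrderLE τ) fun z hz lam mu => ?_
      rw [E₁deriv_zero_add_period hz]; ring
  | succ k ih =>
    exact ih.dz.congr fun τ z hz => ((hasPartials_E₁deriv k).hasDerivAt_z hz).deriv.symm

/-! ### Entire quasi-periodic functions -/

lemma eq_of_continuous_of_eq_off_lattice {τ : ℍ} {u v : ℂ → ℂ} (hu : Continuous u)
    (hv : Continuous v) (h : ∀ z ∉ lattice τ, u z = v z) (z : ℂ) : u z = v z := by
  refine tendsto_nhds_unique_of_eventuallyEq (f := u) (g := v) (l := 𝓝[≠] z)
    ((hu.tendsto z).mono_left nhdsWithin_le_nhds) ((hv.tendsto z).mono_left nhdsWithin_le_nhds) ?_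
  exact (eventually_punctured_off_lattice τ z).mono h

/-- A function holomorphic off the lattice with removable singularities extends to an entire
function. -/
lemma exists_entire_extension {τ : ℍ} {f : ℂ → ℂ}
    (hd : ∀ z ∉ lattice τ, DifferentiableAt ℂ f z) (h0 : ∀ w ∈ lattice τ, HasPoleOrderLE 0 f w) :
    ∃ u : ℂ → ℂ, Differentiable ℂ u ∧ ∀ z ∉ lattice τ, u z = f z := by
  have hdo : DifferentiableOn ℂ f {z | z ∉ lattice τ} := fun z hz =>
    (hd z hz).differentiableWithinAt
  have han (z : ℂ) (hz : z ∉ lattice τ) : AnalyticAt ℂ f z :=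
    hdo.analyticAt ((isOpen_off_lattice_right τ).mem_nhds hz)
  have hw (w : ℂ) : ∃ h : ℂ → ℂ, AnalyticAt ℂ h w ∧ ∀ᶠ z in 𝓝[≠] w, f z = h z := by
    by_cases hmem : w ∈ lattice τ
    · simpa [HasPoleOrderLE] using h0 w hmem
    · exact ⟨f, han w hmem, by simp⟩
  choose h hh he using hw
  have hlim (w : ℂ) : Tendsto f (𝓝[≠] w) (𝓝 (h w w)) :=
    ((hh w).continuousAt.tendsto.mono_left nhdsWithin_le_nhds).congr' ((he w).mono fun z hz => hz.symm)
  refine ⟨fun w => h w w, fun w => ?_, fun z hz => ?_⟩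
  · have : (fun z => h z z) =ᶠ[𝓝 w] h w := by
      rw [EventuallyEq, ← nhdsNE_sup_pure w, eventually_sup]
      refine ⟨?_, by simp⟩
      filter_upwards [eventually_eventually_nhdsWithin.2 (he w), self_mem_nhdsWithin,
        nhdsWithin_le_nhds (hh w).eventually_analyticAt] with z hz hne hzan
      rw [IsOpen.nhdsWithin_eq isOpen_compl_singleton hne] at hz
      refine tendsto_nhds_unique (hlim z) ?_
      exact (hzan.continuousAt.tendsto.mono_left nhdsWithin_le_nhds).congr'
        (nhdsWithin_le_nhds (hz.mono fun x hx => hx.symm))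
    exact ((hh w).congr this.symm).differentiableAt
  · exact tendsto_nhds_unique (hlim z)
      ((hd z hz).continuousAt.tendsto.mono_left nhdsWithin_le_nhds)

/-- Liouville's theorem for entire elliptic functions. -/
lemma exists_eq_const_of_periodic {τ : ℍ} {v : ℂ → ℂ} (hv : Differentiable ℂ v)
    (h : ∀ (z : ℂ) (lam mu : ℤ), v (z + lam * τ + mu) = v z) : ∃ c, ∀ z, v z = c := by
  refine hv.exists_const_forall_eq_of_bounded ?_
  -- All values are attained on a closed period parallelogram.
  have hK : IsCompact ((fun p : ℝ × ℝ => v (p.1 + p.2 * τ)) ''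
      (Set.Icc (0 : ℝ) 1 ×ˢ Set.Icc (0 : ℝ) 1)) := by
    refine (isCompact_Icc.prod isCompact_Icc).image ?_
    exact hv.continuous.comp (by fun_prop)
  refine hK.isBounded.subset ?_
  rintro _ ⟨z, rfl⟩
  have h0 : τ.im ≠ 0 := τ.im_ne_zero
  set y := z.im / τ.im with hy
  set x := z.re - y * τ.re with hx
  have hz : z = x + y * τ := by
    refine Complex.ext ?_ ?_
    · simp [hx]
    · simp [hy, h0]
  refine ⟨(Int.fract x, Int.fract y), ⟨⟨Int.fract_nonneg _, (Int.fract_lt_one _).le⟩,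
    Int.fract_nonneg _, (Int.fract_lt_one _).le⟩, ?_⟩
  have := h (Int.fract x + Int.fract y * τ) ⌊y⌋ ⌊x⌋
  simp only
  rw [← this]
  congr 1
  rw [hz, Int.fract, Int.fract]
  push_cast
  ring

/-- A quasi-periodic function without poles is constant. -/
lemma exists_eq_const_of_quasiperiodic {τ : ℍ} {f : ℂ → ℂ} {C : ℂ}
    (hd : ∀ z ∉ lattice τ, DifferentiableAt ℂ f z) (h0 : HasPoleOrderLE 0 f 0)
    (h1 : ∀ z ∉ lattice τ, f (z + 1) = f z) (h2 : ∀ z ∉ lattice τ, f (z + τ) = f z + C) :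
    ∃ β, ∀ z ∉ lattice τ, f z = β := by
  obtain ⟨u, hu, huf⟩ := exists_entire_extension hd
    (hasPoleOrderLE_of_quasiperiodic h0 fun z hz => add_int_mul_period h1 h2 hz)
  have hper (lam mu : ℤ) (z : ℂ) : u (z + lam * τ + mu) = u z + C * lam := by
    refine eq_of_continuous_of_eq_off_lattice (τ := τ) (u := fun z => u (z + lam * τ + mu))
      (v := fun z => u z + C * lam) (hu.continuous.comp (by fun_prop))
      (hu.continuous.add continuous_const) (fun z hz => ?_) z
    rw [huf _ (by simpa), huf z hz, add_int_mul_period h1 h2 hz]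
  -- The derivative is genuinely doubly periodic, hence constant; so `u` is affine, and the period 1
  -- forces slope zero.
  have hu' : Differentiable ℂ (deriv u) := by
    rw [← differentiableOn_univ] at hu ⊢
    exact hu.deriv isOpen_univ
  obtain ⟨α, hα⟩ := exists_eq_const_of_periodic (τ := τ) hu' fun z lam mu => by
    have e : (fun x => u (x + (lam * τ + mu))) = fun x => u x + C * lam :=
      funext fun x => by rw [← add_assoc, hper]
    rw [add_assoc, ← deriv_comp_add_const, e, deriv_add_const]
  have hlin (z : ℂ) : u z - α * z = u 0 := by
    have hdiff : Differentiable ℂ fun z => u z - α * z := hu.sub (by fun_prop)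
    have := is_const_of_deriv_eq_zero hdiff (fun z => ?_) z 0
    · simpa using this
    · have := (hu z).hasDerivAt.fun_sub ((hasDerivAt_id z).const_mul α)
      rw [mul_one, hα, sub_self] at this
      exact this.deriv
  have hα0 : α = 0 := by
    have e1 := hper 0 1 0
    have e2 := hlin 1
    simp only [Int.cast_zero, zero_mul, add_zero, zero_add, Int.cast_one, mul_zero] at e1
    rw [e1] at e2
    linear_combination -e2
  refine ⟨u 0, fun z hz => ?_⟩
  rw [← huf z hz, ← hlin z, hα0]
  ring

/-! ### The heat equation for `E₁` -/

lemma E₁deriv_succ_add_tau (k : ℕ) {τ : ℍ} {z : ℂ} (hz : z ∉ lattice τ) :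
    E₁deriv (k + 1) τ (z + τ) = E₁deriv (k + 1) τ z := by
  have key : ∀ k, (∃ C, ∀ z ∉ lattice τ, E₁deriv k τ (z + τ) = E₁deriv k τ z + C) →
      ∀ z ∉ lattice τ, E₁deriv (k + 1) τ (z + τ) = E₁deriv (k + 1) τ z := by
    rintro k ⟨C, hC⟩ z hz
    have hz' : z + τ ∉ lattice τ := by simpa
    have h1 := ((hasPartials_E₁deriv k).hasDerivAt_z hz').comp_add_const z τ
    have h2 := ((hasPartials_E₁deriv k).hasDerivAt_z hz).add_const C
    exact h1.unique (h2.congr_of_eventuallyEq ((eventually_z_off_lattice hz).mono hC))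
  induction k generalizing z with
  | zero => exact key 0 ⟨_, fun z hz => by rw [E₁deriv_zero_add_tau hz, sub_eq_add_neg]⟩ z hz
  | succ k ih => exact key (k + 1) ⟨0, fun z hz => by rw [ih hz, add_zero]⟩ z hz

lemma E₁deriv_neg (k : ℕ) {τ : ℍ} {z : ℂ} (hz : z ∉ lattice τ) :
    E₁deriv k τ (-z) = (-1) ^ (k + 1) * E₁deriv k τ z := by
  induction k generalizing z with
  | zero => rw [E₁deriv_zero_neg hz]; ring
  | succ k ih =>
    have h1 := ((hasPartials_E₁deriv k).hasDerivAt_z (off_lattice_neg hz)).comp z (hasDerivAt_neg z)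
    have h2 := ((hasPartials_E₁deriv k).hasDerivAt_z hz).const_mul ((-1) ^ (k + 1))
    have := h1.unique (h2.congr_of_eventuallyEq ((eventually_z_off_lattice hz).mono fun x hx => ih hx))
    rw [pow_succ]
    linear_combination -this

/-- This is the `τ`-derivative of `E₁(τ, z + τ) = E₁(τ, z) - 2πi` at fixed `z`; the moving argument
contributes `E₁'`. -/
lemma E₁derivTau_zero_add_tau {τ : ℍ} {z : ℂ} (hz : z ∉ lattice τ) :
    E₁derivTau 0 τ (z + τ) = E₁derivTau 0 τ z - E₁deriv 1 τ z := by
  have hz' : z + τ ∉ lattice τ := by simpa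
  have h1 := (hasPartials_E₁deriv 0).comp hz' (hasDerivAt_id (τ : ℂ))
    ((hasDerivAt_id (τ : ℂ)).const_add z) rfl rfl
  have h2 := (((hasPartials_E₁deriv 0).comp hz (hasDerivAt_id (τ : ℂ))
    (hasDerivAt_const (τ : ℂ) z) rfl rfl)).sub_const (2 * Real.pi * Complex.I)
  have h3 := h1.unique (h2.congr_of_eventuallyEq ?_)
  · rw [← E₁deriv_succ_add_tau 0 hz]
    linear_combination h3
  · filter_upwards [eventually_tau_off_lattice hz] with t ht
    have := E₁deriv_zero_add_tau ht.2
    simpa [ofComplex_apply_of_im_pos ht.1] using this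

/-- The expansion `E₁ = 1 / z + z b` at `z = 0`. -/
lemma exists_E₁deriv_zero_eq : ∃ b : Fun2, HasCuspTaylor b ∧
    ∀ τ, ∀ᶠ z in 𝓝[≠] (0 : ℂ), E₁deriv 0 τ z = z⁻¹ + z * b τ z := by
  obtain ⟨g, hg, hg0, e⟩ := E₁deriv_laurent 0
  simp only [pow_zero, Nat.factorial_zero, Nat.cast_one, mul_one, zero_add, pow_one] at hg0 e
  obtain ⟨g₁, hg₁, e₁⟩ := (hg.sub (HasCuspTaylor.coeff (HolomorphicWithCusp.const 1))).exists_eq_mul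
    fun τ => by rw [hg0, sub_self]
  -- The constant term of the odd function `E₁` vanishes. Without this, `E₁ E₁'` would keep a double
  -- pole in the heat equation.
  have h0 (τ : ℍ) : g₁ τ 0 = 0 := by
    have hneg : Tendsto (fun z : ℂ => -z) (𝓝[≠] 0) (𝓝[≠] 0) := by
      refine tendsto_nhdsWithin_of_tendsto_nhds_of_eventually_within _ ?_ ?_
      · have : Continuous fun z : ℂ => -z := by fun_prop
        simpa using (this.tendsto 0).mono_left nhdsWithin_le_nhds
      · filter_upwards [self_mem_nhdsWithin] with z hz
        exact neg_ne_zero.2 hz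
    have hc := (hg₁.1 τ).continuousAt.tendsto
    have h1 : Tendsto (fun z => g₁ τ (-z)) (𝓝[≠] 0) (𝓝 (g₁ τ 0)) :=
      (hc.mono_left nhdsWithin_le_nhds).comp hneg
    have h2 : Tendsto (fun z => -g₁ τ z) (𝓝[≠] 0) (𝓝 (-g₁ τ 0)) :=
      (hc.mono_left nhdsWithin_le_nhds).neg
    have h3 : g₁ τ 0 = -g₁ τ 0 := by
      refine tendsto_nhds_unique h1 (h2.congr' ?_)
      filter_upwards [e τ, hneg.eventually (e τ), eventually_punctured_off_lattice τ 0,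
        self_mem_nhdsWithin] with z h1 h2 hz hne
      rw [E₁deriv_zero_neg hz] at h2
      have h3 := e₁ τ z
      have h4 := e₁ τ (-z)
      rw [← h1] at h3
      rw [← h2] at h4
      refine mul_left_cancel₀ hne ?_
      linear_combination h3 - h4
    linear_combination h3 / 2
  obtain ⟨b, hb, e₂⟩ := hg₁.exists_eq_mul h0
  refine ⟨b, hb, fun τ => ?_⟩
  filter_upwards [e τ, self_mem_nhdsWithin] with z hz hne
  have hne : z ≠ 0 := hne
  have h1 := e₁ τ z
  rw [← hz, e₂] at h1
  refine mul_left_cancel₀ hne ?_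
  rw [mul_add, mul_inv_cancel₀ hne]
  linear_combination h1

/-- The heat equation `2πi ∂E₁/∂τ = E₁ E₁' + E₁'' / 2`. -/
lemma heat_equation {τ : ℍ} {z : ℂ} (hz : z ∉ lattice τ) :
    2 * Real.pi * Complex.I * E₁derivTau 0 τ z =
      E₁deriv 0 τ z * E₁deriv 1 τ z + 1 / 2 * E₁deriv 2 τ z := by
  obtain ⟨b, hb, e⟩ := exists_E₁deriv_zero_eq
  set f : ℂ → ℂ := fun z => 2 * Real.pi * Complex.I * E₁derivTau 0 τ z -
    (E₁deriv 0 τ z * E₁deriv 1 τ z + 1 / 2 * E₁deriv 2 τ z) with hf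
  have hE (k : ℕ) (z : ℂ) (hz : z ∉ lattice τ) := (hasPartials_E₁deriv k).hasDerivAt_z hz
  have hd (z : ℂ) (hz : z ∉ lattice τ) : DifferentiableAt ℂ f z :=
    ((hasDerivAt_E₁derivTau 0 (nome_ne_one_of_off_lattice' hz)
      (nome_ne_one_of_off_lattice' (off_lattice_neg hz))).differentiableAt.const_mul _).sub
      (((hE 0 z hz).differentiableAt.mul (hE 1 z hz).differentiableAt).add
        ((hE 2 z hz).differentiableAt.const_mul _))
  -- With `E₁ = 1 / z + z b`, the triple poles of `E₁ E₁'` and `E₁'' / 2` cancel, as do the two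
  -- terms `b / z` within `E₁ E₁'`.
  have hpole : HasPoleOrderLE 0 f 0 := by
    have hbd := (hb.1 τ)
    refine ⟨fun z => 2 * Real.pi * Complex.I * E₁derivTau 0 τ z -
      (2 * deriv (b τ) z + z * b τ z ^ 2 + z ^ 2 * b τ z * deriv (b τ) z +
        1 / 2 * z * deriv (deriv (b τ)) z), ?_, ?_⟩
    · have h1 := analyticAt_E₁derivTau 0 τ
      have h2 := hbd.deriv
      have h3 := hbd.deriv.deriv
      fun_prop
    · have h1 : ∀ᶠ z in 𝓝[≠] (0 : ℂ),
          E₁deriv 1 τ z = -(z ^ 2)⁻¹ + (b τ z + z * deriv (b τ) z) := by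
        filter_upwards [eventually_eventually_nhdsWithin.2 (e τ), self_mem_nhdsWithin,
          nhdsWithin_le_nhds hbd.eventually_analyticAt, eventually_punctured_off_lattice τ 0]
          with z hz hne hbz hzl
        rw [IsOpen.nhdsWithin_eq isOpen_compl_singleton hne] at hz
        have h := ((hasDerivAt_inv hne).fun_add ((hasDerivAt_id z).fun_mul
          hbz.differentiableAt.hasDerivAt)).congr_of_eventuallyEq hz
        simpa using (hE 0 z hzl).unique h
      have h2 : ∀ᶠ z in 𝓝[≠] (0 : ℂ),
          E₁deriv 2 τ z = 2 * (z ^ 3)⁻¹ + (2 * deriv (b τ) z + z * deriv (deriv (b τ)) z) := by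
        filter_upwards [eventually_eventually_nhdsWithin.2 h1, self_mem_nhdsWithin,
          nhdsWithin_le_nhds hbd.eventually_analyticAt, eventually_punctured_off_lattice τ 0]
          with z hz hne hbz hzl
        have hne' : z ≠ 0 := hne
        rw [IsOpen.nhdsWithin_eq isOpen_compl_singleton hne] at hz
        have h := ((((hasDerivAt_pow 2 z).fun_inv (pow_ne_zero 2 hne')).fun_neg).fun_add
          (hbz.differentiableAt.hasDerivAt.fun_add ((hasDerivAt_id z).fun_mul
          hbz.deriv.differentiableAt.hasDerivAt))).congr_of_eventuallyEq hz
        rw [(hE 1 z hzl).unique h]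
        simp only [id]
        field_simp
        ring
      filter_upwards [e τ, h1, h2, self_mem_nhdsWithin] with z h0 h1 h2 hne
      have hne : z ≠ 0 := hne
      rw [hf]
      simp only [h0, h1, h2]
      field_simp
      ring
  -- Along `τ` both sides of the heat equation change by `-2πi E₁'`, so the difference is elliptic
  -- without poles, hence constant.
  obtain ⟨β, hβ⟩ := exists_eq_const_of_quasiperiodic (C := 0) hd hpole
    (fun z hz => by
      have hD : E₁derivTau 0 τ (z + 1) = E₁derivTau 0 τ z := by
        have h1 := nomeSeries_add_intCast 1 (nomeDeriv^[0 + 1] cotKernel) τ z 1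
        have h2 := nomeSeries_add_intCast 1 (nomeDeriv^[0 + 1] cotKernel) τ (-z) (-1)
        push_cast at h1 h2
        rw [E₁derivTau, E₁derivTau, h1, neg_add, h2]
      simp only [hf, hD, (isSingular_E₁deriv _).periodic_z τ z hz])
    (fun z hz => by
      simp only [hf, E₁derivTau_zero_add_tau hz, E₁deriv_succ_add_tau 0 hz,
        E₁deriv_succ_add_tau 1 hz, E₁deriv_zero_add_tau hz]
      ring)
  -- A constant odd function is zero.
  have hodd : f (-z) = -f z := by
    have hD : E₁derivTau 0 τ (-z) = -E₁derivTau 0 τ z := by simp [E₁derivTau]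
    simp only [hf, hD, E₁deriv_neg _ hz]
    ring
  have h1 := hβ z hz
  rw [hβ _ (off_lattice_neg hz), h1] at hodd
  have h2 : f z = 0 := by rw [h1]; linear_combination hodd / 2
  exact sub_eq_zero.1 h2

/-! ### The modular group -/

lemma cocycleJ_ne_zero (g : SL(2, ℤ)) (τ : ℍ) : cocycleJ g τ ≠ 0 := by
  have := denom_ne_zero (g : GL (Fin 2) ℝ) τ
  rwa [ModularGroup.denom_apply] at this

lemma det_eq_one (g : SL(2, ℤ)) : (g 0 0 : ℂ) * g 1 1 - g 0 1 * g 1 0 = 1 := by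
  have := Matrix.det_fin_two g.1
  rw [g.2] at this
  exact_mod_cast this.symm

lemma coe_smul_mul_cocycleJ (g : SL(2, ℤ)) (τ : ℍ) :
    ((g • τ : ℍ) : ℂ) * cocycleJ g τ = g 0 0 * τ + g 0 1 := by
  have h := cocycleJ_ne_zero g τ
  rw [coe_specialLinearGroup_apply]
  simp only [algebraMap_int_eq, eq_intCast, Complex.ofReal_intCast]
  exact div_mul_cancel₀ _ h

lemma div_cocycleJ_mem_lattice {g : SL(2, ℤ)} {τ : ℍ} {z : ℂ} :
    z / cocycleJ g τ ∈ lattice (g • τ) ↔ z ∈ lattice τ := by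
  have hJ := cocycleJ_ne_zero g τ
  have hs := coe_smul_mul_cocycleJ g τ
  have hdet := det_eq_one g
  have hJd : cocycleJ g τ = g 1 0 * τ + g 1 1 := rfl
  constructor
  · rintro ⟨m, n, h⟩
    rw [div_eq_iff hJ] at h
    refine ⟨m * g 1 1 + n * g 0 1, m * g 1 0 + n * g 0 0, ?_⟩
    rw [h, add_mul, mul_assoc, hs, hJd]
    push_cast
    ring
  · rintro ⟨m, n, h⟩
    refine ⟨m * g 0 0 - n * g 0 1, n * g 1 1 - m * g 1 0, ?_⟩
    rw [div_eq_iff hJ, h, add_mul, mul_assoc, hs, hJd]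
    push_cast
    linear_combination (-(m : ℂ) - n * τ) * hdet

/-- The modular transformation of `E₁`. -/
lemma E₁deriv_zero_smul (g : SL(2, ℤ)) {τ : ℍ} {z : ℂ} (hz : z ∉ lattice τ) :
    E₁deriv 0 (g • τ) (z / cocycleJ g τ) =
      cocycleJ g τ * E₁deriv 0 τ z + 2 * Real.pi * Complex.I * g 1 0 * z := by
  have hJ := cocycleJ_ne_zero g τ
  have hs := coe_smul_mul_cocycleJ g τ
  have hdet := det_eq_one g
  have hJd : cocycleJ g τ = g 1 0 * τ + g 1 1 := rfl
  set J := cocycleJ g τ with hJdef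
  set f : ℂ → ℂ := fun z => E₁deriv 0 (g • τ) (z / J) - J * E₁deriv 0 τ z -
    2 * Real.pi * Complex.I * g 1 0 * z with hf
  have hoff {z : ℂ} (hz : z ∉ lattice τ) : z / J ∉ lattice (g • τ) := by
    rwa [hJdef, div_cocycleJ_mem_lattice]
  have hd (z : ℂ) (hz : z ∉ lattice τ) : DifferentiableAt ℂ f z := by
    have h1 := ((hasPartials_E₁deriv 0).hasDerivAt_z (hoff hz)).comp z
      ((hasDerivAt_id z).div_const J)
    exact (h1.differentiableAt.sub
      (((hasPartials_E₁deriv 0).hasDerivAt_z hz).differentiableAt.const_mul _)).sub (by fun_prop)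
  -- The polar part of `E₁` at `z / J` is `J / z`, the same as that of `J * E₁`.
  have hpole : HasPoleOrderLE 0 f 0 := by
    obtain ⟨b, hb, e⟩ := exists_E₁deriv_zero_eq
    have ht : Tendsto (fun z : ℂ => z / J) (𝓝[≠] 0) (𝓝[≠] 0) := by
      refine tendsto_nhdsWithin_of_tendsto_nhds_of_eventually_within _ ?_ ?_
      · have : Continuous fun z : ℂ => z / J := by fun_prop
        simpa using (this.tendsto 0).mono_left nhdsWithin_le_nhds
      · filter_upwards [self_mem_nhdsWithin] with z hz
        exact div_ne_zero hz hJ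
    refine ⟨fun z => z / J * b (g • τ) (z / J) - J * (z * b τ z) -
      2 * Real.pi * Complex.I * g 1 0 * z, ?_, ?_⟩
    · have h1 := hb.1 τ
      have h2 : AnalyticAt ℂ (fun z => b (g • τ) (z / J)) 0 := by
        have : AnalyticAt ℂ (b (g • τ)) (0 / J) := by simpa using hb.1 (g • τ)
        exact this.comp (f := fun z : ℂ => z / J) (by fun_prop)
      have h3 : AnalyticAt ℂ (fun z : ℂ => z / J) 0 := by fun_prop
      exact ((h3.fun_mul h2).fun_sub (analyticAt_const.fun_mul
        (analyticAt_id.fun_mul h1))).fun_sub (by fun_prop)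
    · filter_upwards [e τ, ht.eventually (e (g • τ)), self_mem_nhdsWithin] with z h1 h2 hne
      have hne : z ≠ 0 := hne
      simp only [hf, h1, h2]
      field_simp
      ring
  -- Since `g` has determinant 1, `(nτ + m) / J = (nd - mc) gτ + (ma - nb)`; the correction `2πi c
  -- z` absorbs the resulting increments.
  have hper (m n : ℤ) (z : ℂ) (hz : z ∉ lattice τ) :
      E₁deriv 0 (g • τ) ((z + n * τ + m) / J) =
        E₁deriv 0 (g • τ) (z / J) - 2 * Real.pi * Complex.I * (n * g 1 1 - m * g 1 0) := by
    have h1 := E₁deriv_zero_add_period (hoff hz) (n * g 1 1 - m * g 1 0) (m * g 0 0 - n * g 0 1)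
    push_cast at h1
    rw [← h1]
    congr 1
    refine mul_right_cancel₀ hJ ?_
    rw [div_mul_cancel₀ _ hJ, add_mul, add_mul, div_mul_cancel₀ _ hJ, mul_assoc, hs, hJd]
    linear_combination (-(m : ℂ) - n * τ) * hdet
  obtain ⟨β, hβ⟩ := exists_eq_const_of_quasiperiodic (C := 0) hd hpole
    (fun z hz => by
      have h1 := hper 1 0 z hz
      have h2 := E₁deriv_zero_add_period hz 0 1
      push_cast at h1 h2
      simp only [zero_mul, add_zero, mul_zero] at h1 h2
      simp only [hf, h1, h2]
      ring)
    (fun z hz => by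
      have h1 := hper 0 1 z hz
      have h2 := E₁deriv_zero_add_tau hz
      push_cast at h1 h2
      simp only [one_mul, add_zero] at h1
      simp only [hf, h1, h2]
      linear_combination 2 * Real.pi * Complex.I * hJd)
  have hodd : f (-z) = -f z := by
    simp only [hf, neg_div, E₁deriv_zero_neg hz, E₁deriv_zero_neg (hoff hz)]
    ring
  have h1 := hβ z hz
  rw [hβ _ (off_lattice_neg hz), h1] at hodd
  have h2 : f z = 0 := by rw [h1]; linear_combination hodd / 2
  simp only [hf] at h2
  linear_combination h2

lemma E₁deriv_zero_slash (g : SL(2, ℤ)) (lam mu : ℤ) {τ : ℍ} {z : ℂ} (hz : z ∉ lattice τ) :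
    E₁deriv 0 (g • τ) ((z + lam * τ + mu) / cocycleJ g τ) =
      cocycleJ g τ * (E₁deriv 0 τ z + 2 * Real.pi * Complex.I * cocycleY g lam mu τ z) := by
  have hJ := cocycleJ_ne_zero g τ
  have hJd : cocycleJ g τ = g 1 0 * τ + g 1 1 := rfl
  have hY : cocycleJ g τ * cocycleY g lam mu τ z = g 1 0 * z + g 1 0 * mu - g 1 1 * lam :=
    mul_div_cancel₀ _ hJ
  rw [E₁deriv_zero_smul g (by simpa), E₁deriv_zero_add_period hz]
  linear_combination -2 * Real.pi * Complex.I * hY - 2 * Real.pi * Complex.I * lam * hJd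

lemma e₂_eq (τ : ℍ) : e₂ τ = (Real.pi : ℂ) ^ 2 / 3 * EisensteinSeries.E2 τ := by
  have h (n : ℕ+) : Complex.exp (2 * Real.pi * Complex.I * (n : ℕ) * (τ : ℂ)) =
      Complex.exp (2 * Real.pi * Complex.I * τ) ^ (n : ℕ) := by
    rw [← Complex.exp_nat_mul]
    congr 1
    ring
  simp only [e₂, EisensteinSeries.E2_eq_tsum_cexp, h]

/-- The normalisation `π² / 3 = 2ζ(2)` gives the anomaly the constant `2πi`, up to sign that of
`E₁`. -/
lemma e₂_smul (g : SL(2, ℤ)) (τ : ℍ) : e₂ (g • τ) =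
    cocycleJ g τ ^ 2 * (e₂ τ - 2 * Real.pi * Complex.I * cocycleX g τ) := by
  have hJ := cocycleJ_ne_zero g τ
  have h := congrFun (EisensteinSeries.E2_slash_action g) τ
  rw [ModularForm.SL_slash_apply, ModularGroup.denom_apply] at h
  simp only [Pi.sub_apply, Pi.smul_apply, EisensteinSeries.D2, ModularGroup.denom_apply,
    riemannZeta_two, smul_eq_mul] at h
  change EisensteinSeries.E2 (g • τ) * cocycleJ g τ ^ (-2 : ℤ) = EisensteinSeries.E2 τ -
    1 / (2 * ((Real.pi : ℂ) ^ 2 / 6)) * ((2 * Real.pi * Complex.I * g 1 0) / cocycleJ g τ) at h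
  have hpi : (Real.pi : ℂ) ≠ 0 := by exact_mod_cast Real.pi_ne_zero
  rw [zpow_neg, ← div_eq_mul_inv, div_eq_iff (zpow_ne_zero _ hJ)] at h
  rw [e₂_eq, e₂_eq, h, cocycleX]
  norm_cast
  push_cast
  field_simp
  ring

lemma holomorphicWithCusp_e₂ : HolomorphicWithCusp e₂ := by
  refine ⟨?_, fun r => (Real.pi : ℂ) ^ 2 / 3 * (if r = 0 then 1 else -24 * (σ 1 r : ℂ)), fun τ => ?_⟩
  · have : e₂ = fun τ => (Real.pi : ℂ) ^ 2 / 3 * EisensteinSeries.E2 τ := funext e₂_eq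
    rw [this]
    exact mdifferentiable_const.mul E2_mdifferentiable
  · rw [e₂_eq]
    refine ((EisensteinSeries.hasSum_qExpansion_E2 (z := τ)).mul_left _).congr_fun fun n => ?_
    have h : Complex.exp (2 * Real.pi * Complex.I * n * (τ : ℂ)) =
        Complex.exp (2 * Real.pi * Complex.I * τ) ^ n := by
      rw [← Complex.exp_nat_mul]
      congr 1
      ring
    rw [h, smul_eq_mul, mul_assoc]

/-! ### Polynomials in the derivatives of `E₁` -/

/-- The functions that are, off the lattice, polynomials in `E₁` and its `z`-derivatives, with
coefficients holomorphic in `τ` with a Fourier expansion. -/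
inductive IsEisPoly : Fun2 → Prop
  | coeff {A : ℍ → ℂ} (hA : HolomorphicWithCusp A) : IsEisPoly fun τ _ => A τ
  | gen (k : ℕ) : IsEisPoly (E₁deriv k)
  | add {f g : Fun2} (hf : IsEisPoly f) (hg : IsEisPoly g) : IsEisPoly fun τ z => f τ z + g τ z
  | mul {f g : Fun2} (hf : IsEisPoly f) (hg : IsEisPoly g) : IsEisPoly fun τ z => f τ z * g τ z
  | congr {f g : Fun2} (hf : IsEisPoly f) (h : ∀ τ, ∀ z ∉ lattice τ, g τ z = f τ z) : IsEisPoly g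

lemma IsSingular.pow {f : Fun2} (hf : IsSingular f) (n : ℕ) : IsSingular fun τ z => f τ z ^ n := by
  induction n with
  | zero => simpa using IsSingular.coeff (HolomorphicWithCusp.const 1)
  | succ n ih => simpa [pow_succ] using ih.mul hf

lemma IsSingular.sum {ι : Type*} (s : Finset ι) {f : ι → Fun2} (hf : ∀ i ∈ s, IsSingular (f i)) :
    IsSingular fun τ z => ∑ i ∈ s, f i τ z := by
  classical
  induction s using Finset.induction_on with
  | empty => simpa using IsSingular.coeff (HolomorphicWithCusp.const 0)
  | insert i s hi ih =>
    simp only [Finset.sum_insert hi]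
    exact (hf i (by simp)).add (ih fun j hj => hf j (by simp [hj]))

lemma IsSingular.const_mul {f : Fun2} (hf : IsSingular f) (c : ℂ) :
    IsSingular fun τ z => c * f τ z :=
  (IsSingular.coeff (HolomorphicWithCusp.const c)).mul hf

namespace IsEisPoly

variable {f g : Fun2}

lemma isSingular (hf : IsEisPoly f) : IsSingular f := by
  induction hf with
  | coeff hA => exact IsSingular.coeff hA
  | gen k => exact isSingular_E₁deriv k
  | add _ _ ih ih' => exact ih.add ih'
  | mul _ _ ih ih' => exact ih.mul ih'
  | congr _ h ih => exact ih.congr h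

lemma const (c : ℂ) : IsEisPoly fun _ _ => c := .coeff (HolomorphicWithCusp.const c)

lemma const_mul (hf : IsEisPoly f) (c : ℂ) : IsEisPoly fun τ z => c * f τ z := (const c).mul hf

lemma pow (hf : IsEisPoly f) (n : ℕ) : IsEisPoly fun τ z => f τ z ^ n := by
  induction n with
  | zero => simpa using const 1
  | succ n ih => simpa [pow_succ] using ih.mul hf

lemma sum {ι : Type*} (s : Finset ι) {f : ι → Fun2} (hf : ∀ i ∈ s, IsEisPoly (f i)) :
    IsEisPoly fun τ z => ∑ i ∈ s, f i τ z := by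
  classical
  induction s using Finset.induction_on with
  | empty => simpa using const 0
  | insert i s hi ih =>
    simp only [Finset.sum_insert hi]
    exact (hf i (by simp)).add (ih fun j hj => hf j (by simp [hj]))

lemma dz (hf : IsEisPoly f) : IsEisPoly (dz f) := by
  induction hf with
  | coeff hA => exact (const 0).congr fun τ z _ => deriv_const z _
  | gen k => exact (gen (k + 1)).congr fun τ z hz => ((hasPartials_E₁deriv k).hasDerivAt_z hz).deriv
  | @add f g hf hg ih ih' =>
    refine (ih.add ih').congr fun τ z hz => ?_
    exact deriv_fun_add (hf.isSingular.holomorphic_off τ z hz) (hg.isSingular.holomorphic_off τ z hz)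
  | @mul f g hf hg ih ih' =>
    refine ((ih.mul hg).add (hf.mul ih')).congr fun τ z hz => ?_
    exact deriv_fun_mul (hf.isSingular.holomorphic_off τ z hz) (hg.isSingular.holomorphic_off τ z hz)
  | congr _ h ih =>
    exact ih.congr fun τ z hz =>
      EventuallyEq.deriv_eq ((eventually_z_off_lattice hz).mono fun x hx => h τ x hx)

/-- The heat equation settles `k = 0`; the other cases follow by differentiating in `z`. -/
lemma e₁derivTau (k : ℕ) : IsEisPoly (E₁derivTau k) := by
  induction k with
  | zero =>
    refine ((((gen 0).mul (gen 1)).add ((gen 2).const_mul (1 / 2))).const_mul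
      (2 * Real.pi * Complex.I)⁻¹).congr fun τ z hz => ?_
    rw [← heat_equation hz, inv_mul_cancel_left₀ Complex.two_pi_I_ne_zero]
  | succ k ih =>
    exact ih.dz.congr fun τ z hz => (hasDerivAt_E₁derivTau k (nome_ne_one_of_off_lattice' hz)
      (nome_ne_one_of_off_lattice' (off_lattice_neg hz))).deriv.symm

lemma exists_hasPartials (hf : IsEisPoly f) :
    ∃ ft fz, IsEisPoly ft ∧ IsEisPoly fz ∧ HasPartials f ft fz := by
  induction hf with
  | coeff hA =>
    obtain ⟨B, hB, h⟩ := hA.exists_hasDerivAt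
    exact ⟨_, _, coeff hB, const 0, HasPartials.coeff h⟩
  | gen k => exact ⟨_, _, e₁derivTau k, gen (k + 1), hasPartials_E₁deriv k⟩
  | add _ _ ih ih' =>
    obtain ⟨ft, fz, h1, h2, h3⟩ := ih
    obtain ⟨gt, gz, k1, k2, k3⟩ := ih'
    exact ⟨_, _, h1.add k1, h2.add k2, h3.add k3⟩
  | mul hf hg ih ih' =>
    obtain ⟨ft, fz, h1, h2, h3⟩ := ih
    obtain ⟨gt, gz, k1, k2, k3⟩ := ih'
    exact ⟨_, _, (h1.mul hg).add (hf.mul k1), (h2.mul hg).add (hf.mul k2), h3.mul k3⟩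
  | congr _ h ih =>
    obtain ⟨ft, fz, h1, h2, h3⟩ := ih
    exact ⟨ft, fz, h1, h2, h3.congr h⟩

end IsEisPoly

/-! ### Quasi-periodic singular functions -/

lemma exists_E₁deriv_add_tau (k : ℕ) :
    ∃ C : ℂ, ∀ τ, ∀ z ∉ lattice τ, E₁deriv k τ (z + τ) = E₁deriv k τ z + C := by
  rcases k with _ | k
  · exact ⟨_, fun τ z hz => (E₁deriv_zero_add_tau hz).trans (sub_eq_add_neg _ _)⟩
  · exact ⟨0, fun τ z hz => by rw [E₁deriv_succ_add_tau k hz, add_zero]⟩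

/-- A singular function whose increment along the period `τ` is independent of `z` is a polynomial
in the derivatives of `E₁`. -/
lemma isEisPoly_of_quasiperiodic (N : ℕ) {f : Fun2} {C : ℍ → ℂ} (hN : HasCuspLaurent N f)
    (hd : ∀ τ, ∀ z ∉ lattice τ, DifferentiableAt ℂ (f τ) z)
    (h1 : ∀ τ, ∀ z ∉ lattice τ, f τ (z + 1) = f τ z)
    (h2 : ∀ τ, ∀ z ∉ lattice τ, f τ (z + τ) = f τ z + C τ) : IsEisPoly f := by
  induction N generalizing f C with
  | zero =>
    -- Without poles the function is constant in `z` for each `τ`, and that constant is its zeroth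
    -- Taylor coefficient, so it has a cusp expansion.
    obtain ⟨g, hg, e⟩ := id hN
    have hc (τ : ℍ) := exists_eq_const_of_quasiperiodic (hd τ) (hN.hasPoleOrderLE τ) (h1 τ) (h2 τ)
    choose β hβ using hc
    have hβg (τ : ℍ) : g τ 0 = β τ := by
      refine tendsto_nhds_unique
        ((hg.1 τ).continuousAt.tendsto.mono_left (nhdsWithin_le_nhds (s := {0}ᶜ)))
        (tendsto_const_nhds.congr' ?_)
      filter_upwards [e τ, eventually_punctured_off_lattice τ 0] with z hz hzl
      rw [← hz, hβ τ z hzl, pow_zero, one_mul]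
    have := IsEisPoly.coeff (hg.2 0)
    simp only [iteratedDeriv_zero, hβg] at this
    exact this.congr hβ
  | succ N ih =>
    obtain ⟨g, hg, e⟩ := hN
    obtain ⟨u, hu, hu0, eu⟩ := E₁deriv_laurent N
    -- A simple pole is removed by `E₁` itself, which is only quasi-periodic. Allowing an increment
    -- `C` keeps the induction going without the residue theorem.
    obtain ⟨C', hC'⟩ := exists_E₁deriv_add_tau N
    set c : ℂ := ((-1) ^ N * N.factorial)⁻¹ with hc
    have hne : ((-1) ^ N * N.factorial : ℂ) ≠ 0 :=
      mul_ne_zero (pow_ne_zero _ (by norm_num)) (by exact_mod_cast N.factorial_ne_zero)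
    have hA : HolomorphicWithCusp fun τ => -(g τ 0) * c := by
      have := ((HolomorphicWithCusp.const (-1)).mul (hg.2 0)).mul (HolomorphicWithCusp.const c)
      simpa using this
    have hsing : IsEisPoly fun τ z => -(g τ 0) * c * E₁deriv N τ z := (IsEisPoly.coeff hA).mul (.gen N)
    have key : IsEisPoly fun τ z => f τ z + -(g τ 0) * c * E₁deriv N τ z := by
      -- The leading coefficients cancel, so one factor `z` splits off and the pole order drops to
      -- `N`.
      obtain ⟨h, hh, eh⟩ := (hg.add ((HasCuspTaylor.coeff hA).mul hu)).exists_eq_mul fun τ => by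
        rw [hu0, mul_assoc, inv_mul_cancel₀ hne]; ring
      refine ih (C := fun τ => C τ + -(g τ 0) * c * C') ⟨h, hh, fun τ => ?_⟩ (fun τ z hz => ?_)
        (fun τ z hz => ?_) (fun τ z hz => ?_)
      · filter_upwards [e τ, eu τ, self_mem_nhdsWithin] with z hz hz' hz0
        have h3 := eh τ z
        rw [← hz, ← hz'] at h3
        refine mul_left_cancel₀ hz0 ?_
        rw [← h3]
        ring
      · exact (hd τ z hz).add (hsing.isSingular.holomorphic_off τ z hz)
      · rw [h1 τ z hz, (isSingular_E₁deriv N).periodic_z τ z hz]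
      · rw [h2 τ z hz, hC' τ z hz]; ring
    refine (key.add (hsing.const_mul (-1))).congr fun τ z _ => ?_
    ring

/-! ### Polynomials of bounded degree and their translates. -/

open Polynomial in
/-- The polynomial with coefficients `a`. -/
def finPoly {n : ℕ} (a : Fin n → ℂ) : ℂ[X] := ∑ i, C (a i) * X ^ (i : ℕ)

section finPoly

open Polynomial

variable {n : ℕ}

lemma eval_finPoly (a : Fin n → ℂ) (x : ℂ) : (finPoly a).eval x = ∑ i, a i * x ^ (i : ℕ) := by
  simp [finPoly, eval_finsetSum]

lemma coeff_finPoly (a : Fin n → ℂ) (j : Fin n) : (finPoly a).coeff j = a j := by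
  simp only [finPoly, finsetSum_coeff, coeff_C_mul_X_pow, Fin.val_inj]
  simp

lemma finPoly_injective : Function.Injective (finPoly (n := n)) := fun a b h =>
  funext fun j => by rw [← coeff_finPoly a j, h, coeff_finPoly]

/-- For `i < j` the truncated exponent `i - j` is harmless, since the binomial coefficient vanishes.
-/
lemma taylor_finPoly (r : ℂ) (a : Fin n → ℂ) : taylor r (finPoly a) =
    finPoly fun j : Fin n => ∑ i, a i * (r ^ ((i : ℕ) - j) * ((i : ℕ).choose j : ℂ)) := by
  ext k
  have hL : (taylor r (finPoly a)).coeff k =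
      ∑ i, a i * (r ^ ((i : ℕ) - k) * ((i : ℕ).choose k : ℂ)) := by
    simp only [finPoly, map_sum, taylor_mul, taylor_C, taylor_pow, taylor_X, finsetSum_coeff,
      coeff_C_mul, coeff_X_add_C_pow]
  rw [hL]
  by_cases hk : k < n
  · exact (coeff_finPoly (fun j : Fin n => ∑ i, a i * (r ^ ((i : ℕ) - j) *
      ((i : ℕ).choose j : ℂ))) ⟨k, hk⟩).symm
  · have hk' (i : Fin n) : (i : ℕ) < k := by omega
    rw [finPoly, finsetSum_coeff, Finset.sum_eq_zero, Finset.sum_eq_zero]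
    · exact fun i _ => by rw [coeff_C_mul_X_pow, if_neg (hk' i).ne']
    · exact fun i _ => by rw [Nat.choose_eq_zero_of_lt (hk' i), Nat.cast_zero, mul_zero, mul_zero]

end finPoly

/-- Singular functions that transform along the period `τ` like the coefficients of a polynomial
under translation are polynomials in the derivatives of `E₁`. -/
lemma isEisPoly_of_translation {n : ℕ} {h : Fin n → Fun2} (hs : ∀ j, IsSingular (h j))
    (ht : ∀ τ, ∀ z ∉ lattice τ, finPoly (fun j => h j τ (z + τ)) =
      Polynomial.taylor (-1) (finPoly fun j => h j τ z)) (j : Fin n) : IsEisPoly (h j) := by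
  -- `T` drops by 1 along `τ`, so translating the polynomial by `-T` compensates its translation by
  -- `-1`, and the coefficients `g` become elliptic.
  set T : Fun2 := fun τ z => (2 * Real.pi * Complex.I)⁻¹ * E₁deriv 0 τ z with hT
  have hTE : IsEisPoly T := (IsEisPoly.gen 0).const_mul _
  have hTt (τ : ℍ) (z : ℂ) (hz : z ∉ lattice τ) : T τ (z + τ) = T τ z - 1 := by
    rw [hT]
    beta_reduce
    rw [E₁deriv_zero_add_tau hz, mul_sub, inv_mul_cancel₀ Complex.two_pi_I_ne_zero]
  set g : Fin n → Fun2 := fun j τ z =>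
    ∑ i, h i τ z * ((-1 * T τ z) ^ ((i : ℕ) - j) * ((i : ℕ).choose j : ℂ)) with hg
  have hgp (τ : ℍ) (z : ℂ) : finPoly (fun j => g j τ z) =
      Polynomial.taylor (-1 * T τ z) (finPoly fun j => h j τ z) := (taylor_finPoly _ _).symm
  have hgs (j : Fin n) : IsSingular (g j) := by
    refine IsSingular.sum _ fun i _ => (hs i).mul (IsSingular.mul ?_
      (IsSingular.coeff (HolomorphicWithCusp.const _)))
    exact (hTE.isSingular.const_mul (-1)).pow _
  have hge (j : Fin n) : IsEisPoly (g j) := by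
    obtain ⟨k1, -, k3, N, -, k5⟩ := isSingular_iff.1 (hgs j)
    refine isEisPoly_of_quasiperiodic N (C := 0) k5 k3 k1 fun τ z hz => ?_
    have : finPoly (fun j => g j τ (z + τ)) = finPoly fun j => g j τ z := by
      rw [hgp, hgp, ht τ z hz, Polynomial.taylor_taylor, hTt τ z hz]
      congr 2
      ring
    simpa using congrFun (finPoly_injective this) j
  -- Translating back by `T` recovers `h` from `g`.
  have hinv (τ : ℍ) (z : ℂ) : h j τ z =
      ∑ i, g i τ z * (T τ z ^ ((i : ℕ) - j) * ((i : ℕ).choose j : ℂ)) := by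
    have h1 := taylor_finPoly (T τ z) fun j => g j τ z
    rw [hgp, Polynomial.taylor_taylor] at h1
    simp only [neg_mul, one_mul, add_neg_cancel, Polynomial.taylor_zero] at h1
    exact congrFun (finPoly_injective h1) j
  have hfun : h j = fun τ z =>
      ∑ i, g i τ z * (T τ z ^ ((i : ℕ) - j) * ((i : ℕ).choose j : ℂ)) := by
    funext τ z; exact hinv τ z
  rw [hfun]
  exact IsEisPoly.sum _ fun i _ => (hge i).mul ((hTE.pow _).mul (IsEisPoly.const _))

/-! ### Components of quasi-Jacobi forms -/

lemma finPoly_ext_of_infinite {n : ℕ} {a b : Fin n → ℂ} {Y : ℕ → ℂ} (hY : Function.Injective Y)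
    (h : ∀ l, ∑ j, a j * Y l ^ (j : ℕ) = ∑ j, b j * Y l ^ (j : ℕ)) : a = b := by
  refine finPoly_injective (Polynomial.eq_of_infinite_eval_eq _ _
    ((Set.infinite_range_of_injective hY).mono ?_))
  rintro _ ⟨l, rfl⟩
  simpa only [Set.mem_ofPred_eq, eval_finPoly] using h l

lemma finPoly_ext_of_infinite₂ {m n : ℕ} {a b : Fin m → Fin n → ℂ} {X : ℕ → ℂ}
    (hX : Function.Injective X) {Y : ℕ → ℕ → ℂ} (hY : ∀ i, Function.Injective (Y i))
    (h : ∀ i l, ∑ j₁, ∑ j₂, a j₁ j₂ * X i ^ (j₁ : ℕ) * Y i l ^ (j₂ : ℕ) =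
      ∑ j₁, ∑ j₂, b j₁ j₂ * X i ^ (j₁ : ℕ) * Y i l ^ (j₂ : ℕ)) : a = b := by
  have h1 (i : ℕ) : (fun j₂ => ∑ j₁, a j₁ j₂ * X i ^ (j₁ : ℕ)) =
      fun j₂ => ∑ j₁, b j₁ j₂ * X i ^ (j₁ : ℕ) := by
    refine finPoly_ext_of_infinite (hY i) fun l => ?_
    simp only [Finset.sum_mul]
    rw [Finset.sum_comm, h i l, Finset.sum_comm]
  funext j₁ j₂
  exact congrFun (finPoly_ext_of_infinite (a := (a · j₂)) (b := (b · j₂)) hX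
    fun i => congrFun (h1 i) j₂) j₁

/-- The matrix with lower row `(1, n + 1)`. -/
def shiftMatrix (n : ℕ) : SL(2, ℤ) := ⟨!![0, -1; 1, n + 1], by simp [Matrix.det_fin_two]⟩

lemma cocycleJ_shiftMatrix (n : ℕ) (τ : ℍ) : cocycleJ (shiftMatrix n) τ = τ + (n + 1) := by
  simp [cocycleJ, shiftMatrix]

lemma cocycleX_shiftMatrix (n : ℕ) (τ : ℍ) : cocycleX (shiftMatrix n) τ = (τ + (n + 1) : ℂ)⁻¹ := by
  rw [cocycleX, cocycleJ_shiftMatrix]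
  simp [shiftMatrix]

lemma cocycleY_shiftMatrix (n : ℕ) (lam : ℤ) (τ : ℍ) (z : ℂ) :
    cocycleY (shiftMatrix n) lam 0 τ z = (z - (n + 1) * lam) / (τ + (n + 1)) := by
  rw [cocycleY, cocycleJ_shiftMatrix]
  simp [shiftMatrix]

/-- The matrices give infinitely many values of `X`, and for each of them, as `d = n + 1` is
nonzero, varying `lam` gives infinitely many values of `Y`. Hence the components of an expansion are
unique. -/
lemma cocycleX_shiftMatrix_injective (τ : ℍ) :
    Function.Injective fun n => cocycleX (shiftMatrix n) τ := by
  intro m n h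
  simp only [cocycleX_shiftMatrix, inv_inj] at h
  exact_mod_cast add_right_cancel (add_left_cancel h)

lemma cocycleY_shiftMatrix_injective (n : ℕ) (τ : ℍ) (z : ℂ) :
    Function.Injective fun l : ℕ => cocycleY (shiftMatrix n) l 0 τ z := by
  intro l m h
  have hJ := cocycleJ_ne_zero (shiftMatrix n) τ
  rw [cocycleJ_shiftMatrix] at hJ
  have hn : (n + 1 : ℂ) ≠ 0 := by exact_mod_cast n.succ_ne_zero
  simp only [cocycleY_shiftMatrix] at h
  exact_mod_cast mul_left_cancel₀ hn (sub_right_injective ((div_left_inj' hJ).1 h))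

/-- The components of the expansion of the translates of a function transform along the period `τ`
like the coefficients of a polynomial. -/
lemma finPoly_component_add_tau {k s₁ s₂ : ℕ} {f : Fun2} {F : Fin (s₁ + 1) → Fin (s₂ + 1) → Fun2}
    (h : ∀ (g : SL(2, ℤ)) (lam mu : ℤ) (τ : ℍ), ∀ z ∉ lattice τ, slash k f g lam mu τ z =
      ∑ j₁, ∑ j₂, F j₁ j₂ τ z * cocycleX g τ ^ (j₁ : ℕ) * cocycleY g lam mu τ z ^ (j₂ : ℕ))
    (j₁ : Fin (s₁ + 1)) {τ : ℍ} {z : ℂ} (hz : z ∉ lattice τ) :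
    finPoly (fun j₂ => F j₁ j₂ τ (z + τ)) =
      Polynomial.taylor (-1) (finPoly fun j₂ => F j₁ j₂ τ z) := by
  rw [taylor_finPoly]
  congr 1
  refine congrFun (finPoly_ext_of_infinite₂ (a := fun j₁ j₂ => F j₁ j₂ τ (z + τ))
    (b := fun j₁ j => ∑ i, F j₁ i τ z * ((-1) ^ ((i : ℕ) - j) * ((i : ℕ).choose j : ℂ)))
    (cocycleX_shiftMatrix_injective τ)
    (fun n => cocycleY_shiftMatrix_injective n τ (z + τ)) fun n l => ?_) j₁
  have hJ := cocycleJ_ne_zero (shiftMatrix n) τ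
  rw [cocycleJ_shiftMatrix] at hJ
  -- Replacing `z` by `z + τ` has the same effect on the translate as raising `lam` by one, but the
  -- two values of `Y` differ by `(cτ + d) / (cτ + d) = 1`.
  have hY : cocycleY (shiftMatrix n) (l + 1) 0 τ z =
      cocycleY (shiftMatrix n) l 0 τ (z + τ) + -1 := by
    rw [cocycleY_shiftMatrix, cocycleY_shiftMatrix]
    field_simp
    push_cast
    ring
  have hs : slash k f (shiftMatrix n) l 0 τ (z + τ) = slash k f (shiftMatrix n) (l + 1) 0 τ z := by
    simp only [slash]
    congr 3
    push_cast
    ring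
  rw [← h (shiftMatrix n) l 0 τ (z + τ) (by rwa [add_tau_mem_lattice]), hs, h _ _ _ τ z hz, hY]
  refine Finset.sum_congr rfl fun j₁ _ => ?_
  have h1 := congrArg (Polynomial.eval (cocycleY (shiftMatrix n) l 0 τ (z + τ)))
    (taylor_finPoly (-1) fun j₂ => F j₁ j₂ τ z)
  rw [Polynomial.taylor_eval, eval_finPoly, eval_finPoly] at h1
  simp only [mul_right_comm _ (cocycleX (shiftMatrix n) τ ^ (j₁ : ℕ)), ← Finset.sum_mul]
  rw [h1]

lemma slash_one (k : ℕ) (f : Fun2) (τ : ℍ) (z : ℂ) : slash k f 1 0 0 τ z = f τ z := by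
  simp [slash, cocycleJ]

/-- At the identity `X = Y = 0`. -/
lemma eq_component_zero {k s₁ s₂ : ℕ} {f : Fun2} {F : Fin (s₁ + 1) → Fin (s₂ + 1) → Fun2}
    (h : ∀ (g : SL(2, ℤ)) (lam mu : ℤ) (τ : ℍ), ∀ z ∉ lattice τ, slash k f g lam mu τ z =
      ∑ j₁, ∑ j₂, F j₁ j₂ τ z * cocycleX g τ ^ (j₁ : ℕ) * cocycleY g lam mu τ z ^ (j₂ : ℕ))
    (τ : ℍ) (z : ℂ) (hz : z ∉ lattice τ) : f τ z = F 0 0 τ z := by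
  have := h 1 0 0 τ z hz
  rw [slash_one] at this
  rw [this, Fin.sum_univ_succ, Fin.sum_univ_succ, Finset.sum_eq_zero, Finset.sum_eq_zero]
  · simp
  · intro i _; simp [cocycleX]
  · intro i _; simp [cocycleY]

/-- Quasi-Jacobi forms and their components are polynomials in the derivatives of `E₁`. -/
lemma IsQuasiJacobi.exists_isEisPoly {k s₁ s₂ : ℕ} {f : Fun2} (hf : IsQuasiJacobi k s₁ s₂ f) :
    IsEisPoly f ∧ ∃ F : Fin (s₁ + 1) → Fin (s₂ + 1) → Fun2, (∀ j₁ j₂, IsEisPoly (F j₁ j₂)) ∧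
      ∀ (g : SL(2, ℤ)) (lam mu : ℤ) (τ : ℍ), ∀ z ∉ lattice τ, slash k f g lam mu τ z =
        ∑ j₁, ∑ j₂, F j₁ j₂ τ z * cocycleX g τ ^ (j₁ : ℕ) * cocycleY g lam mu τ z ^ (j₂ : ℕ) := by
  obtain ⟨-, F, hF, h⟩ := hf
  have hE (j₁ : Fin (s₁ + 1)) (j₂ : Fin (s₂ + 1)) : IsEisPoly (F j₁ j₂) :=
    isEisPoly_of_translation (hF j₁) (fun _ _ hz => finPoly_component_add_tau h j₁ hz) j₂
  exact ⟨(hE 0 0).congr (eq_component_zero h), F, hE, h⟩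

lemma IsSingularJacobi.isQuasiJacobi {k : ℕ} {f : Fun2} (hf : IsSingularJacobi k f) :
    IsQuasiJacobi k 0 0 f :=
  ⟨hf.1, fun _ _ => f, fun _ _ => hf.1, fun g lam mu τ z hz => by simp [hf.2 g lam mu τ z hz]⟩

/-! ### The Oberdieck derivation and the action of `SL(2, ℤ) ⋉ ℤ²` -/

section Partials

variable {f ft fz : Fun2}

lemma HasPartials.pow (h : HasPartials f ft fz) (n : ℕ) :
    HasPartials (fun τ z => f τ z ^ n) (fun τ z => n * f τ z ^ (n - 1) * ft τ z)
      (fun τ z => n * f τ z ^ (n - 1) * fz τ z) := fun τ z hz => by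
  refine ((h τ z hz).pow n).congr_fderiv ?_
  simp only [ofComplex_apply, nsmul_eq_mul]
  module

lemma HasPartials.sum {ι : Type*} (s : Finset ι) {f ft fz : ι → Fun2}
    (h : ∀ i ∈ s, HasPartials (f i) (ft i) (fz i)) :
    HasPartials (fun τ z => ∑ i ∈ s, f i τ z) (fun τ z => ∑ i ∈ s, ft i τ z)
      (fun τ z => ∑ i ∈ s, fz i τ z) := fun τ z hz => by
  refine (HasFDerivAt.fun_sum fun i hi => h i hi τ z hz).congr_fderiv ?_
  ext <;> simp

lemma hasPartials_snd : HasPartials (fun _ z => z) (fun _ _ => 0) (fun _ _ => 1) :=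
  fun τ z _ => by
    refine hasFDerivAt_snd.congr_fderiv ?_
    module

/-- The constant is `4 · π / (2i) = -2πi`. -/
lemma oberdieck_eq (h : HasPartials f ft fz) (k : ℕ) {τ : ℍ} {z : ℂ} (hz : z ∉ lattice τ) :
    oberdieck k f τ z = -(2 * Real.pi * Complex.I) * ft τ z + E₁deriv 0 τ z * fz τ z -
      k * e₂ τ * f τ z := by
  rw [oberdieck, dtau, dz, (h.hasDerivAt_tau hz).deriv, (h.hasDerivAt_z hz).deriv, E₁_eq hz,
    div_mul_eq_div_div, Complex.div_I]
  ring

end Partials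

lemma oberdieck_congr {f g : Fun2} (h : ∀ τ, ∀ z ∉ lattice τ, f τ z = g τ z) (k : ℕ) {τ : ℍ} {z : ℂ}
    (hz : z ∉ lattice τ) : oberdieck k f τ z = oberdieck k g τ z := by
  have h1 : deriv (tauSlice f z) τ = deriv (tauSlice g z) τ := EventuallyEq.deriv_eq
    ((eventually_tau_off_lattice hz).mono fun t ht => h _ z ht.2)
  have h2 : deriv (f τ) z = deriv (g τ) z := EventuallyEq.deriv_eq
    ((eventually_z_off_lattice hz).mono fun x hx => h τ x hx)
  simp only [oberdieck, dtau, dz, h1, h2, h τ z hz]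

lemma IsEisPoly.oberdieck {f : Fun2} (hf : IsEisPoly f) (k : ℕ) : IsEisPoly (oberdieck k f) := by
  obtain ⟨ft, fz, ht, hz, h⟩ := hf.exists_hasPartials
  refine (((ht.const_mul (-(2 * Real.pi * Complex.I))).add ((gen 0).mul hz)).add
    ((((coeff holomorphicWithCusp_e₂).const_mul k).mul hf).const_mul (-1))).congr
    fun τ z hz => ?_
  rw [oberdieck_eq h k hz]
  ring

section Cocycle

variable (g : SL(2, ℤ)) (lam mu : ℤ)

lemma hasDerivAt_cocycleJ (τ : ℍ) :
    HasDerivAt (fun s => cocycleJ g (ofComplex s)) (g 1 0 : ℂ) (τ : ℂ) := by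
  have h1 : HasDerivAt (fun s : ℂ => (g 1 0 : ℂ) * s + (g 1 1 : ℂ)) (g 1 0 : ℂ) (τ : ℂ) := by
    simpa using ((hasDerivAt_id (τ : ℂ)).const_mul (g 1 0 : ℂ)).add_const (g 1 1 : ℂ)
  refine h1.congr_of_eventuallyEq ?_
  filter_upwards [isOpen_upperHalfPlaneSet.mem_nhds τ.im_pos] with s hs
  simp [cocycleJ, ofComplex_apply_of_im_pos hs]

lemma hasDerivAt_smul (τ : ℍ) :
    HasDerivAt (fun s => ((g • ofComplex s : ℍ) : ℂ)) (cocycleJ g τ ^ 2)⁻¹ (τ : ℂ) := by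
  have hJ := cocycleJ_ne_zero g τ
  have h1 : HasDerivAt (fun s : ℂ => (g 0 0 : ℂ) * s + (g 0 1 : ℂ)) (g 0 0 : ℂ) (τ : ℂ) := by
    simpa using ((hasDerivAt_id (τ : ℂ)).const_mul (g 0 0 : ℂ)).add_const (g 0 1 : ℂ)
  refine ((h1.fun_div (hasDerivAt_cocycleJ g τ) (by simpa)).congr_of_eventuallyEq
    ?_).congr_deriv ?_
  · filter_upwards [isOpen_upperHalfPlaneSet.mem_nhds τ.im_pos] with s hs
    have := coe_smul_mul_cocycleJ g (ofComplex s)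
    rw [eq_div_iff (cocycleJ_ne_zero g _), this, ofComplex_apply_of_im_pos hs]
  · have hJd : cocycleJ g τ = g 1 0 * τ + g 1 1 := rfl
    have hd : (g 0 0 : ℂ) * g 1 1 - g 0 1 * g 1 0 = 1 := det_eq_one g
    rw [ofComplex_apply, inv_eq_one_div]
    congr 1
    linear_combination (g 0 0 : ℂ) * hJd + hd

lemma hasPartials_cocycleX :
    HasPartials (fun τ _ => cocycleX g τ) (fun τ _ => -cocycleX g τ ^ 2) (fun _ _ => 0) := by
  refine HasPartials.coeff fun τ => ?_
  refine ((hasDerivAt_const (τ : ℂ) (g 1 0 : ℂ)).fun_div (hasDerivAt_cocycleJ g τ)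
    (by simpa using cocycleJ_ne_zero g τ)).congr_deriv ?_
  simp only [cocycleX, ofComplex_apply]
  ring

lemma hasPartials_cocycleY :
    HasPartials (cocycleY g lam mu) (fun τ z => -(cocycleX g τ * cocycleY g lam mu τ z))
      (fun τ _ => cocycleX g τ) := by
  have h1 (τ : ℍ) : HasDerivAt (fun s => ((g 1 0 : ℂ) * mu - g 1 1 * lam) / cocycleJ g (ofComplex s))
      (-((g 1 0 : ℂ) * mu - g 1 1 * lam) * g 1 0 / cocycleJ g τ ^ 2) (τ : ℂ) := by
    refine ((hasDerivAt_const (τ : ℂ) ((g 1 0 : ℂ) * mu - g 1 1 * lam)).fun_div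
      (hasDerivAt_cocycleJ g τ) (by simpa using cocycleJ_ne_zero g τ)).congr_deriv ?_
    simp only [ofComplex_apply]
    ring
  -- `Y` is split as `X z` plus a term independent of `z`.
  refine ((((hasPartials_cocycleX g).mul hasPartials_snd).add (HasPartials.coeff
    (A := fun τ => ((g 1 0 : ℂ) * mu - g 1 1 * lam) / cocycleJ g τ) h1)).congr
      fun τ z _ => ?_).congr_partials (fun τ z _ => ?_) (fun τ z _ => ?_)
  · simp only [cocycleX, cocycleY]; ring
  · simp only [cocycleX, cocycleY]; ring
  · ring

/-- The Oberdieck derivation commutes with the action. -/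
lemma slash_oberdieck {f ft fz : Fun2} (h : HasPartials f ft fz) (k : ℕ) {τ : ℍ} {z : ℂ}
    (hz : z ∉ lattice τ) : slash (k + 2) (oberdieck k f) g lam mu τ z =
      oberdieck k (slash k f g lam mu) τ z := by
  have hJ := cocycleJ_ne_zero g τ
  have hJd : cocycleJ g τ = g 1 0 * τ + g 1 1 := rfl
  have hX : cocycleJ g τ * cocycleX g τ = g 1 0 := mul_div_cancel₀ _ hJ
  have hY : cocycleJ g τ * cocycleY g lam mu τ z = g 1 0 * z + g 1 0 * mu - g 1 1 * lam :=
    mul_div_cancel₀ _ hJ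
  have hw : (z + lam * τ + mu) / cocycleJ g τ ∉ lattice (g • τ) := by
    rw [div_cocycleJ_mem_lattice]; simpa using hz
  have hz' : HasDerivAt (slash k f g lam mu τ) ((cocycleJ g τ ^ k)⁻¹ *
      (fz (g • τ) ((z + lam * τ + mu) / cocycleJ g τ) / cocycleJ g τ)) z := by
    have hv : HasDerivAt (fun x : ℂ => (x + lam * τ + mu) / cocycleJ g τ) (1 / cocycleJ g τ) z :=
      (((hasDerivAt_id z).add_const _).add_const _).div_const _
    have := h.comp hw (hasDerivAt_const z _) hv rfl rfl
    refine HasDerivAt.congr_deriv (f := slash k f g lam mu τ) ((this.const_mul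
      (cocycleJ g τ ^ k)⁻¹).congr_of_eventuallyEq (.of_forall fun x => ?_)) ?_
    · simp [slash]
    · ring
  -- The three terms come from the derivatives of `gτ`, of the elliptic argument and of the
  -- automorphy factor. Multiplied by `-2πi`, the last two match the anomalies of `E₁` and `e₂`.
  have ht' : HasDerivAt (tauSlice (slash k f g lam mu) z) ((cocycleJ g τ ^ k)⁻¹ *
      (ft (g • τ) ((z + lam * τ + mu) / cocycleJ g τ) / cocycleJ g τ ^ 2 -
        fz (g • τ) ((z + lam * τ + mu) / cocycleJ g τ) * cocycleY g lam mu τ z / cocycleJ g τ -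
        k * cocycleX g τ * f (g • τ) ((z + lam * τ + mu) / cocycleJ g τ))) τ := by
    have hn : HasDerivAt (fun s : ℂ => z + lam * s + mu) (lam : ℂ) (τ : ℂ) := by
      simpa using (((hasDerivAt_id (τ : ℂ)).const_mul (lam : ℂ)).const_add z).add_const (mu : ℂ)
    have hv : HasDerivAt (fun s : ℂ => (z + lam * s + mu) / cocycleJ g (ofComplex s))
        (-cocycleY g lam mu τ z / cocycleJ g τ) (τ : ℂ) := by
      refine (hn.fun_div (hasDerivAt_cocycleJ g τ) (by simpa)).congr_deriv ?_
      rw [ofComplex_apply]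
      field_simp
      linear_combination (lam : ℂ) * hJd + hY
    have h1 := h.comp hw (hasDerivAt_smul g τ) hv (by simp) (by simp)
    have h2 := ((hasDerivAt_cocycleJ g τ).fun_pow k).fun_inv
      (by simpa using pow_ne_zero k hJ)
    refine HasDerivAt.congr_deriv ((h2.fun_mul h1).congr_of_eventuallyEq ?_) ?_
    · filter_upwards [isOpen_upperHalfPlaneSet.mem_nhds τ.im_pos] with s hs
      simp [tauSlice, slash, ofComplex_apply_of_im_pos hs]
    · simp only [ofComplex_apply]
      rw [← hX]
      rcases k with _ | k
      · simp
        ring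
      · rw [Nat.add_sub_cancel]
        field_simp
        ring
  rw [slash, oberdieck_eq h k hw, e₂_smul, E₁deriv_zero_slash g lam mu hz, oberdieck, dtau, dz,
    ht'.deriv, hz'.deriv, E₁_eq hz, div_mul_eq_div_div, Complex.div_I, slash]
  field_simp
  ring

end Cocycle

/-! ### Stability of Jacobi and quasi-Jacobi forms under the derivation. -/

lemma oberdieck_sum {ι : Type*} (s : Finset ι) {f ft fz : ι → Fun2}
    (h : ∀ i ∈ s, HasPartials (f i) (ft i) (fz i)) (k : ℕ) {τ : ℍ} {z : ℂ} (hz : z ∉ lattice τ) :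
    oberdieck k (fun τ z => ∑ i ∈ s, f i τ z) τ z = ∑ i ∈ s, oberdieck k (f i) τ z := by
  rw [oberdieck_eq (HasPartials.sum s h) k hz, Finset.sum_congr rfl fun i hi =>
    oberdieck_eq (h i hi) k hz]
  simp only [Finset.sum_sub_distrib, Finset.sum_add_distrib, Finset.mul_sum]

/-- Invariance is equivariance of the derivation; singularity of the image comes from the structure
theorem applied in depth `(0, 0)`. -/
lemma IsSingularJacobi.oberdieck {k : ℕ} {f : Fun2} (hf : IsSingularJacobi k f) :
    IsSingularJacobi (k + 2) (oberdieck k f) := by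
  have hE := hf.isQuasiJacobi.exists_isEisPoly.1
  obtain ⟨ft, fz, -, -, h⟩ := hE.exists_hasPartials
  refine ⟨(hE.oberdieck k).isSingular, fun g lam mu τ z hz => ?_⟩
  rw [slash_oberdieck g lam mu h k hz]
  exact oberdieck_congr (hf.2 g lam mu) k hz

/-- Families of functions that are polynomials in `X` and `Y` of degrees at most `s₁` and `s₂`, with
coefficients that are polynomials in the derivatives of `E₁`. -/
def HasExpansion (s₁ s₂ : ℕ) (S : SL(2, ℤ) → ℤ → ℤ → Fun2) : Prop :=
  ∃ F : Fin (s₁ + 1) → Fin (s₂ + 1) → Fun2, (∀ j₁ j₂, IsEisPoly (F j₁ j₂)) ∧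
    ∀ (g : SL(2, ℤ)) (lam mu : ℤ) (τ : ℍ), ∀ z ∉ lattice τ, S g lam mu τ z =
      ∑ j₁, ∑ j₂, F j₁ j₂ τ z * cocycleX g τ ^ (j₁ : ℕ) * cocycleY g lam mu τ z ^ (j₂ : ℕ)

namespace HasExpansion

variable {s₁ s₂ : ℕ} {S T : SL(2, ℤ) → ℤ → ℤ → Fun2}

lemma congr (hS : HasExpansion s₁ s₂ S)
    (h : ∀ g lam mu τ, ∀ z ∉ lattice τ, T g lam mu τ z = S g lam mu τ z) :
    HasExpansion s₁ s₂ T := by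
  obtain ⟨F, hF, e⟩ := hS
  exact ⟨F, hF, fun g lam mu τ z hz => (h g lam mu τ z hz).trans (e g lam mu τ z hz)⟩

lemma add (hS : HasExpansion s₁ s₂ S) (hT : HasExpansion s₁ s₂ T) :
    HasExpansion s₁ s₂ fun g lam mu τ z => S g lam mu τ z + T g lam mu τ z := by
  obtain ⟨F, hF, e⟩ := hS
  obtain ⟨G, hG, e'⟩ := hT
  refine ⟨fun j₁ j₂ τ z => F j₁ j₂ τ z + G j₁ j₂ τ z, fun j₁ j₂ => (hF j₁ j₂).add (hG j₁ j₂),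
    fun g lam mu τ z hz => ?_⟩
  simp only [e g lam mu τ z hz, e' g lam mu τ z hz, ← Finset.sum_add_distrib, add_mul]

lemma monomial {f : Fun2} (hf : IsEisPoly f) {j₁ j₂ : ℕ} (h₁ : j₁ ≤ s₁) (h₂ : j₂ ≤ s₂) :
    HasExpansion s₁ s₂ fun g lam mu τ z =>
      f τ z * cocycleX g τ ^ j₁ * cocycleY g lam mu τ z ^ j₂ := by
  refine ⟨fun i₁ i₂ τ z => if (i₁ : ℕ) = j₁ ∧ (i₂ : ℕ) = j₂ then f τ z else 0, fun i₁ i₂ => ?_,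
    fun g lam mu τ z _ => ?_⟩
  · by_cases h : (i₁ : ℕ) = j₁ ∧ (i₂ : ℕ) = j₂
    · simpa only [h, and_self, if_true] using hf
    · simpa only [h, if_false] using IsEisPoly.const 0
  · rw [Finset.sum_eq_single ⟨j₁, by omega⟩, Finset.sum_eq_single ⟨j₂, by omega⟩]
    · simp
    · intro i _ hi
      simp [Fin.ext_iff] at hi
      simp [hi]
    · simp
    · intro i _ hi
      simp [Fin.ext_iff] at hi
      simp [hi]
    · simp

lemma sum {ι : Type*} (s : Finset ι) {S : ι → SL(2, ℤ) → ℤ → ℤ → Fun2}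
    (h : ∀ i ∈ s, HasExpansion s₁ s₂ (S i)) :
    HasExpansion s₁ s₂ fun g lam mu τ z => ∑ i ∈ s, S i g lam mu τ z := by
  classical
  induction s using Finset.induction_on with
  | empty =>
    exact (monomial (IsEisPoly.const 0) (Nat.zero_le _) (Nat.zero_le _)).congr
      fun g lam mu τ z _ => by simp
  | insert i s hi ih =>
    simp only [Finset.sum_insert hi]
    exact (h i (by simp)).add (ih fun j hj => h j (by simp [hj]))

end HasExpansion

lemma HasPartials.mul_cocycle {f ft fz : Fun2} (h : HasPartials f ft fz) (g : SL(2, ℤ))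
    (lam mu : ℤ) (j₁ j₂ : ℕ) :
    HasPartials (fun τ z => f τ z * cocycleX g τ ^ j₁ * cocycleY g lam mu τ z ^ j₂)
      (fun τ z => ft τ z * cocycleX g τ ^ j₁ * cocycleY g lam mu τ z ^ j₂ -
        (j₁ + j₂) * f τ z * cocycleX g τ ^ (j₁ + 1) * cocycleY g lam mu τ z ^ j₂)
      (fun τ z => fz τ z * cocycleX g τ ^ j₁ * cocycleY g lam mu τ z ^ j₂ +
        j₂ * f τ z * cocycleX g τ ^ (j₁ + 1) * cocycleY g lam mu τ z ^ (j₂ - 1)) := by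
  refine ((h.mul ((hasPartials_cocycleX g).pow j₁)).mul
    ((hasPartials_cocycleY g lam mu).pow j₂)).congr_partials (fun τ z _ => ?_) (fun τ z _ => ?_)
  · rcases j₁ with _ | j₁ <;> rcases j₂ with _ | j₂ <;> push_cast <;> ring
  · ring

lemma IsQuasiJacobi.oberdieck {k s₁ s₂ : ℕ} {f : Fun2} (hf : IsQuasiJacobi k s₁ s₂ f) :
    IsQuasiJacobi (k + 2) (s₁ + 1) s₂ (oberdieck k f) := by
  obtain ⟨hE, F, hF, e⟩ := hf.exists_isEisPoly
  obtain ⟨ft, fz, -, -, h⟩ := hE.exists_hasPartials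
  choose Ft Fz _ _ hFP using fun j₁ j₂ => (hF j₁ j₂).exists_hasPartials
  suffices hS : HasExpansion (s₁ + 1) s₂ (slash (k + 2) (QuasiJacobi.oberdieck k f)) by
    obtain ⟨G, hG, e'⟩ := hS
    exact ⟨(hE.oberdieck k).isSingular, G, fun j₁ j₂ => (hG j₁ j₂).isSingular, e'⟩
  -- This is `Ob*` applied to each monomial: the second term comes from the `τ`-derivatives of `X`
  -- and `Y`, the third from `∂Y/∂z = X`. At `j₂ = 0` the truncated exponent `j₂ - 1` comes with
  -- coefficient zero.
  have key : HasExpansion (s₁ + 1) s₂ fun g lam mu τ z => ∑ j₁ : Fin (s₁ + 1), ∑ j₂ : Fin (s₂ + 1),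
      (QuasiJacobi.oberdieck k (F j₁ j₂) τ z * cocycleX g τ ^ (j₁ : ℕ) *
          cocycleY g lam mu τ z ^ (j₂ : ℕ) +
        2 * Real.pi * Complex.I * ((j₁ : ℕ) + (j₂ : ℕ)) * F j₁ j₂ τ z *
          cocycleX g τ ^ ((j₁ : ℕ) + 1) * cocycleY g lam mu τ z ^ (j₂ : ℕ) +
        E₁deriv 0 τ z * ((j₂ : ℕ) * F j₁ j₂ τ z) *
          cocycleX g τ ^ ((j₁ : ℕ) + 1) * cocycleY g lam mu τ z ^ ((j₂ : ℕ) - 1)) := by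
    refine HasExpansion.sum _ fun j₁ _ => HasExpansion.sum _ fun j₂ _ =>
      (HasExpansion.add ?_ ?_).add ?_
    · exact HasExpansion.monomial ((hF j₁ j₂).oberdieck k) (by omega) (by omega)
    · exact HasExpansion.monomial ((hF j₁ j₂).const_mul _) (by omega) (by omega)
    · exact HasExpansion.monomial ((IsEisPoly.gen 0).mul ((hF j₁ j₂).const_mul _))
        (by omega) (by omega)
  refine key.congr fun g lam mu τ z hz => ?_
  have hM (j₁ : Fin (s₁ + 1)) (j₂ : Fin (s₂ + 1)) :=
    (hFP j₁ j₂).mul_cocycle g lam mu (j₁ : ℕ) (j₂ : ℕ)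
  rw [slash_oberdieck g lam mu h k hz, oberdieck_congr (e g lam mu) k hz,
    oberdieck_sum _ (fun j₁ _ => HasPartials.sum _ fun j₂ _ => hM j₁ j₂) k hz]
  refine Finset.sum_congr rfl fun j₁ _ => ?_
  rw [oberdieck_sum _ (fun j₂ _ => hM j₁ j₂) k hz]
  refine Finset.sum_congr rfl fun j₂ _ => ?_
  rw [oberdieck_eq (hM j₁ j₂) k hz, oberdieck_eq (hFP j₁ j₂) k hz]
  ring

lemma IsQuasiJacobi.differentiableAt_tauSlice {k s₁ s₂ : ℕ} {f : Fun2}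
    (hf : IsQuasiJacobi k s₁ s₂ f) {τ : ℍ} {z : ℂ} (hz : z ∉ lattice τ) :
    DifferentiableAt ℂ (tauSlice f z) τ := by
  obtain ⟨ft, fz, -, -, h⟩ := hf.exists_isEisPoly.1.exists_hasPartials
  exact (h.hasDerivAt_tau hz).differentiableAt

lemma memJS_sum_oberdieck {K : Finset ℕ} {f : ℕ → Fun2}
    (hf : ∀ k ∈ K, IsSingularJacobi k (f k)) :
    MemJS fun τ z => ∑ k ∈ K, oberdieck k (f k) τ z := by
  -- The family is reindexed by the new weights, all at least 2, so `k - 2` recovers the old one.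
  refine ⟨K.map (addRightEmbedding 2), fun k => oberdieck (k - 2) (f (k - 2)), ?_, fun τ z _ => ?_⟩
  · simp only [Finset.mem_map, addRightEmbedding_apply, forall_exists_index, and_imp]
    rintro _ k hk rfl
    simpa using (hf k hk).oberdieck
  · simp

end QuasiJacobi

end

theorem mainTheorem10 :
    -- forms are differentiable in `τ`, so that the derivation makes sense on them
    (∀ (k s₁ s₂ : ℕ) (f : QuasiJacobi.Fun2), QuasiJacobi.IsQuasiJacobi k s₁ s₂ f →
      ∀ (τ : UpperHalfPlane), ∀ z ∉ QuasiJacobi.lattice τ,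
        DifferentiableAt ℂ (QuasiJacobi.tauSlice f z) (τ : ℂ)) ∧
    -- the derivation raises the weight by 2 and the modular depth by at most 1
    (∀ (k s₁ s₂ : ℕ) (f : QuasiJacobi.Fun2), QuasiJacobi.IsQuasiJacobi k s₁ s₂ f →
      QuasiJacobi.IsQuasiJacobi (k + 2) (s₁ + 1) s₂ (QuasiJacobi.oberdieck k f)) ∧
    -- singular Jacobi forms of weight `k` are mapped to singular Jacobi forms of weight `k + 2`
    (∀ (k : ℕ) (f : QuasiJacobi.Fun2), QuasiJacobi.IsSingularJacobi k f →
      QuasiJacobi.IsSingularJacobi (k + 2) (QuasiJacobi.oberdieck k f)) ∧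
    -- the algebra of singular Jacobi forms is stable under the linear extension
    (∀ (K : Finset ℕ) (f : ℕ → QuasiJacobi.Fun2),
      (∀ k ∈ K, QuasiJacobi.IsSingularJacobi k (f k)) →
      QuasiJacobi.MemJS (fun τ z => ∑ k ∈ K, QuasiJacobi.oberdieck k (f k) τ z)) := by
  exact ⟨fun _ _ _ _ hf _ _ hz => hf.differentiableAt_tauSlice hz, fun _ _ _ _ hf => hf.oberdieck,
    fun _ _ hf => hf.oberdieck, fun _ _ hf => QuasiJacobi.memJS_sum_oberdieck hf⟩
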